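/- **Model.** Consider the slotted downlink of a heterogeneous cloud radio access network with finite sets of remote radio heads (RRHs) $\mathcal R$, HUEs $\mathcal U_H$, RUEs $\mathcal U_R$, RRH-tier resource blocks $\mathcal K_R$ and resource blocks $\mathcal K_H$ of the high power node (HPN). Constants: bandwidths $W,W_0>0$, slot duration $\tau>0$, drain efficiencies $\varphi^R,\varphi^H>0$, static powers $p_c^R,p_c^H\ge0$ with $p_c^R+p_c^H>0$, power limits $p_i^{\max},p_H^{\max}\ge 0$, required energy efficiency $\eta\ge0$, prices $\alpha,\beta>0$, peak arrivals $A_u^{\max}\ge0$. The utility functions $g_R,g_H$ on $[0,\infty)$ are non-decreasing, concave, continuous at $0$ and real-valued, except that the value $-\infty$ is allowed at $0$ (e.g. $\log$). The state of slot $t$ consists of the channel state, with values in a finite set and determining the non-negative gains $g_{ijk}(t),g_{imk}(t),g_{ml}(t)$, and of the arrivals $0\le A_u(t)\le A_u^{\max}$ of the users $u\in\mathcal U_H\cup\mathcal U_R$. The states are i.i.d. over slots with an arbitrary law $\nu$ (unknown to the controller). In slot $t$ a causal (possibly randomized and history-dependent) policy chooses admissions $0\le R_u(t)\le A_u(t)$,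 indicators $s_m,a_{jk},a_{mk},b_{ml}\in\{0,1\}$ and powers $p_{ijk},p_{imk},p_{ml}\ge0$ with $$\sum_j a_{jk}+\sum_m s_ma_{mk}\le1,\quad \sum_m(1-s_m)b_{ml}\le1,\quad p_i\le p_i^{\max},\quad p_H\le p_H^{\max},$$ where $p_i=\sum_{j,k}a_{jk}p_{ijk}+\sum_{m,k}s_ma_{mk}p_{imk}$ and $p_H=\sum_{m,l}(1-s_m)b_{ml}p_{ml}$. The rates are $$\mu_j=\sum_k a_{jk}W_0\log_2\Big(1+\sum_i p_{ijk}g_{ijk}\Big),$$ $$\mu_m=(1-s_m)\sum_l b_{ml}W_0\log_2(1+g_{ml}p_{ml})+s_m\sum_k a_{mk}W_0\log_2\Big(1+\sum_i p_{imk}g_{imk}\Big),$$ and $\mu_{\rm sum}=\sum_u\mu_u$, $p_{\rm sum}=\varphi^R\sum_i p_i+p_c^R+\varphi^Hp_H+p_c^H$. Traffic queues: $Q_u(0)=0$, $Q_u(t+1)=\max\{Q_u(t)-\mu_u(t)\tau,0\}+R_u(t)$. Write $\bar r_u(T)=\frac1T\sum_{t<T}\mathbb E[R_u(t)]$ and $U(r)=\alpha\sum_j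 g_R(r_j)+\beta\sum_m g_H(r_m)$. Let $U^*$ be the supremum of $\limsup_{T\to\infty}U(\bar r(T))$ over all policies for which all $Q_u$ are strongly stable, i.e. $\limsup_T\frac1T\sum_{t<T}\mathbb E[Q_u(t)]<\infty$, and the energy efficiency requirement $$\liminf_{T\to\infty}\frac{\frac1T\sum_{t<T}\mathbb E[\mu_{\rm sum}(t)]}{W\frac1T\sum_{t<T}\mathbb E[p_{\rm sum}(t)]}\ge\eta$$ holds (where the limits of the averages exist, these are the usual long-term averages; $U^*=-\infty$ if there is no such policy). **Algorithm.** For $V\ge0$ the drift-plus-penalty algorithm keeps, besides the $Q_u$, virtual queues with $H_u(0)=Z(0)=0$, $H_u(t+1)=\max\{H_u(t)-R_u(t),0\}+\gamma_u(t)$ and $Z(t+1)=\max\{Z(t)-\mu_{\rm sum}(t),0\}+W\eta\,p_{\rm sum}(t)$. In each slot it chooses $\gamma_u(t)$ maximizing $V\alpha g_R(\gamma)-H_u(t)\gamma$ (RUEs) or $V\beta g_H(\gamma)-H_u(t)\gamma$ (HUEs) over $\gamma\in[0,A_u^{\max}]$; it sets $R_u(t)=A_u(t)$ if $H_u(t)>Q_u(t)$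 and $R_u(t)=0$ otherwise; and it chooses a feasible $(s,a,b,p)$ minimizing $$-\sum_u(Q_u(t)\tau+Z(t))\mu_u+W\eta\varphi^RZ(t)\sum_ip_i+W\eta\varphi^HZ(t)p_H.$$ **Theorem.** There is a finite constant $C$, independent of $V$, such that for every causal policy, all causal auxiliary variables $\gamma_u(t)\in[0,A_u^{\max}]$ and every $t$, almost surely $$C\ \ge\ \tfrac12\,\mathbb E\Big[(W\eta\,p_{\rm sum}(t))^2+\mu_{\rm sum}(t)^2+\sum_u\big(2R_u(t)^2+\mu_u(t)^2\tau^2+\gamma_u(t)^2\big)\,\Big|\,\chi(t)\Big],$$ where $\chi(t)=(Q(t),H(t),Z(t))$. For every such $C$ and every $V>0$ the algorithm satisfies $$\liminf_{T\to\infty}U(\bar r(T))\ \ge\ U^*-\frac CV ,$$ and hence $U(\bar r)\ge U^*-C/V$ whenever the limit $\bar r=\lim_{T\to\infty}\bar r(T)$ exists. (For $V=0$ the bound reads $C/V=\infty$ and is void.) -/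

import Mathlib

open MeasureTheory ProbabilityTheory Filter Topology Set

noncomputable section

namespace HCRAN

/-- A non-decreasing concave utility function on `[0, ∞)`, continuous at `0`. It is real on `(0, ∞)`;
the value `-∞` is allowed at `0`, so that the logarithmic utility is included. -/
structure IsUtility (g : ℝ → EReal) : Prop where
  finite : ∀ x, 0 < x → g x ≠ ⊥ ∧ g x ≠ ⊤
  mono : MonotoneOn g (Ici 0)
  concave : ConcaveOn ℝ (Ioi 0) (fun x => (g x).toReal)
  cont : ContinuousWithinAt g (Ioi 0) 0

/-- The parameters of the network. `RRH` is the set of RRHs, `UH` and `UR` are the sets of HUEs and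
RUEs, `KR` and `KH` the sets of resource blocks of the RRH tier and of the HPN, and `S` is the state
space of the channels. A user is an element of `UH ⊕ UR`. -/
structure Network (RRH UH UR KR KH S : Type*) where
  /-- system bandwidth -/
  W : ℝ
  /-- bandwidth of a resource block -/
  W₀ : ℝ
  /-- slot duration -/
  τ : ℝ
  /-- drain efficiencies of the RRHs and of the HPN -/
  effR : ℝ
  effH : ℝ
  /-- static power consumptions of the RRHs and of the HPN -/
  pcR : ℝ
  pcH : ℝ
  /-- maximum transmit powers -/
  pmaxR : RRH → ℝ
  pmaxH : ℝ
  /-- required energy efficiency -/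
  ηreq : ℝ
  /-- utility prices of RUEs and HUEs -/
  α : ℝ
  β : ℝ
  /-- utility functions of RUEs and HUEs -/
  gR : ℝ → EReal
  gH : ℝ → EReal
  /-- peak arrivals -/
  Amax : UH ⊕ UR → ℝ
  /-- channel gains RRH to RUE, RRH to HUE, and HPN to HUE, in each channel state -/
  gainR : S → RRH → UR → KR → ℝ
  gainH : S → RRH → UH → KR → ℝ
  gainM : S → UH → KH → ℝ
  W_pos : 0 < W
  W₀_pos : 0 < W₀
  τ_pos : 0 < τ
  effR_pos : 0 < effR
  effH_pos : 0 < effH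
  pcR_nonneg : 0 ≤ pcR
  pcH_nonneg : 0 ≤ pcH
  pc_pos : 0 < pcR + pcH
  pmaxR_nonneg : ∀ i, 0 ≤ pmaxR i
  pmaxH_nonneg : 0 ≤ pmaxH
  ηreq_nonneg : 0 ≤ ηreq
  α_pos : 0 < α
  β_pos : 0 < β
  gR_utility : IsUtility gR
  gH_utility : IsUtility gH
  Amax_nonneg : ∀ u, 0 ≤ Amax u
  gainR_nonneg : ∀ x i j k, 0 ≤ gainR x i j k
  gainH_nonneg : ∀ x i m k, 0 ≤ gainH x i m k
  gainM_nonneg : ∀ x m l, 0 ≤ gainM x m l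

/-- User association, resource block allocation and power allocation in one slot. -/
structure Decision (RRH UH UR KR KH : Type*) where
  /-- association indicator of the HUEs: 1 for the RRH tier, 0 for the HPN -/
  s : UH → ℝ
  /-- allocation of the RRH tier blocks to the RUEs -/
  aR : UR → KR → ℝ
  /-- allocation of the RRH tier blocks to the HUEs -/
  aH : UH → KR → ℝ
  /-- allocation of the HPN blocks to the HUEs -/
  b : UH → KH → ℝ
  /-- powers RRH to RUE, RRH to HUE, and HPN to HUE -/
  pR : RRH → UR → KR → ℝ
  pH : RRH → UH → KR → ℝ
  pM : UH → KH → ℝ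

/-- The coordinatewise sigma-algebra on decisions. -/
instance Decision.measurableSpace {RRH UH UR KR KH : Type*} :
    MeasurableSpace (Decision RRH UH UR KR KH) :=
  MeasurableSpace.comap (fun d => (d.s, d.aR, d.aH, d.b, d.pR, d.pH, d.pM)) inferInstance

section Slot

variable {RRH UH UR KR KH S : Type*} [Fintype RRH] [Fintype UH] [Fintype UR] [Fintype KR]
  [Fintype KH]

/-- Transmit rate of an RUE. -/
def rateR (N : Network RRH UH UR KR KH S) (x : S) (d : Decision RRH UH UR KR KH) (j : UR) : ℝ :=
  ∑ k, d.aR j k * (N.W₀ * Real.logb 2 (1 + ∑ i, d.pR i j k * N.gainR x i j k))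

/-- Transmit rate of an HUE. -/
def rateH (N : Network RRH UH UR KR KH S) (x : S) (d : Decision RRH UH UR KR KH) (m : UH) : ℝ :=
  (1 - d.s m) * ∑ l, d.b m l * (N.W₀ * Real.logb 2 (1 + N.gainM x m l * d.pM m l))
    + d.s m * ∑ k, d.aH m k * (N.W₀ * Real.logb 2 (1 + ∑ i, d.pH i m k * N.gainH x i m k))

/-- Transmit rate of a user. -/
def rate (N : Network RRH UH UR KR KH S) (x : S) (d : Decision RRH UH UR KR KH) :
    UH ⊕ UR → ℝ :=
  Sum.elim (rateH N x d) (rateR N x d)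

/-- Total transmit rate. -/
def rateSum (N : Network RRH UH UR KR KH S) (x : S) (d : Decision RRH UH UR KR KH) : ℝ :=
  ∑ m, rateH N x d m + ∑ j, rateR N x d j

/-- Transmit power of an RRH. -/
def powerR (d : Decision RRH UH UR KR KH) (i : RRH) : ℝ :=
  ∑ j, ∑ k, d.aR j k * d.pR i j k + ∑ m, ∑ k, d.s m * d.aH m k * d.pH i m k

/-- Transmit power of the HPN. -/
def powerH (d : Decision RRH UH UR KR KH) : ℝ :=
  ∑ m, ∑ l, (1 - d.s m) * (d.b m l * d.pM m l)

/-- Total power consumption. -/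
def powerSum (N : Network RRH UH UR KR KH S) (d : Decision RRH UH UR KR KH) : ℝ :=
  ∑ i, N.effR * powerR d i + N.pcR + N.effH * powerH d + N.pcH

/-- The per-slot constraints: binary indicators, no reuse of resource blocks within a tier,
non-negative powers, and the transmit power limits. -/
structure Feasible (N : Network RRH UH UR KR KH S) (d : Decision RRH UH UR KR KH) : Prop where
  s_binary : ∀ m, d.s m = 0 ∨ d.s m = 1
  aR_binary : ∀ j k, d.aR j k = 0 ∨ d.aR j k = 1
  aH_binary : ∀ m k, d.aH m k = 0 ∨ d.aH m k = 1
  b_binary : ∀ m l, d.b m l = 0 ∨ d.b m l = 1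
  pR_nonneg : ∀ i j k, 0 ≤ d.pR i j k
  pH_nonneg : ∀ i m k, 0 ≤ d.pH i m k
  pM_nonneg : ∀ m l, 0 ≤ d.pM m l
  reuseR : ∀ k, ∑ j, d.aR j k + ∑ m, d.s m * d.aH m k ≤ 1
  reuseH : ∀ l, ∑ m, (1 - d.s m) * d.b m l ≤ 1
  powerR_le : ∀ i, powerR d i ≤ N.pmaxR i
  powerH_le : powerH d ≤ N.pmaxH

/-- The throughput utility `U(r) = α ∑ⱼ g_R(rⱼ) + β ∑ₘ g_H(rₘ)`. -/
def utility (N : Network RRH UH UR KR KH S) (r : UH ⊕ UR → ℝ) : EReal :=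
  (N.α : EReal) * ∑ j, N.gR (r (Sum.inr j)) + (N.β : EReal) * ∑ m, N.gH (r (Sum.inl m))

/-- Price times utility function of a single user. -/
def userUtility (N : Network RRH UH UR KR KH S) : UH ⊕ UR → ℝ → EReal :=
  Sum.elim (fun _ y => (N.β : EReal) * N.gH y) (fun _ y => (N.α : EReal) * N.gR y)

/-- The per-slot association, block and power allocation objective, which is to be minimized, at
traffic queues `q` and energy efficiency queue `z`. -/
def allocObjective (N : Network RRH UH UR KR KH S) (q : UH ⊕ UR → ℝ) (z : ℝ) (x : S)
    (d : Decision RRH UH UR KR KH) : ℝ :=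
  -(∑ m, (q (Sum.inl m) * N.τ + z) * rateH N x d m)
    - (∑ j, (q (Sum.inr j) * N.τ + z) * rateR N x d j)
    + N.W * N.ηreq * N.effR * z * ∑ i, powerR d i
    + N.W * N.ηreq * N.effH * z * powerH d

end Slot

section Dynamics

variable {RRH UH UR KR KH S : Type*} [Fintype RRH] [Fintype UH] [Fintype UR] [Fintype KR]
  [Fintype KH] [MeasurableSpace S] {Ω : Type} [mΩ : MeasurableSpace Ω]

/-- A (possibly randomized and history dependent) causal control policy, together with the network
state it acts on. The state of slot `t` consists of the channel state and of the arrivals of all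
users; the states are i.i.d. over the slots with law `ν`. `info t` is the information available
before the state of slot `t` is revealed; it may contain randomization. The decisions of slot `t`
are the admissions `adm t` and the allocation `dec t`. -/
structure Policy (N : Network RRH UH UR KR KH S) (ν : Measure (S × (UH ⊕ UR → ℝ)))
    (P : Measure Ω) where
  info : Filtration ℕ mΩ
  state : ℕ → Ω → S × (UH ⊕ UR → ℝ)
  adm : ℕ → Ω → UH ⊕ UR → ℝ
  dec : ℕ → Ω → Decision RRH UH UR KR KH
  state_meas : ∀ t, Measurable[info (t + 1)] (state t)
  state_law : ∀ t, P.map (state t) = ν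
  state_indep : ∀ t, Indep (info t) (MeasurableSpace.comap (state t) inferInstance) P
  adm_meas : ∀ t, Measurable[info (t + 1)] (adm t)
  dec_meas : ∀ t, Measurable[info (t + 1)] (dec t)
  adm_mem : ∀ t, ∀ᵐ ω ∂P, ∀ u, 0 ≤ adm t ω u ∧ adm t ω u ≤ (state t ω).2 u
  dec_feasible : ∀ t, ∀ᵐ ω ∂P, Feasible N (dec t ω)

namespace Policy

variable {N : Network RRH UH UR KR KH S} {ν : Measure (S × (UH ⊕ UR → ℝ))} {P : Measure Ω}

/-- Transmit rates in slot `t`. -/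
def μ (π : Policy N ν P) (t : ℕ) (ω : Ω) : UH ⊕ UR → ℝ :=
  rate N (π.state t ω).1 (π.dec t ω)

/-- Total transmit rate in slot `t`. -/
def μsum (π : Policy N ν P) (t : ℕ) (ω : Ω) : ℝ :=
  rateSum N (π.state t ω).1 (π.dec t ω)

/-- Total power consumption in slot `t`. -/
def psum (π : Policy N ν P) (t : ℕ) (ω : Ω) : ℝ :=
  powerSum N (π.dec t ω)

/-- The traffic queues, initially empty. -/
def Q (π : Policy N ν P) : ℕ → Ω → UH ⊕ UR → ℝ
  | 0, _, _ => 0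
  | t + 1, ω, u => max (Q π t ω u - π.μ t ω u * N.τ) 0 + π.adm t ω u

/-- The virtual queues with arrivals given by the auxiliary variables `γ`. -/
def H (π : Policy N ν P) (γ : ℕ → Ω → UH ⊕ UR → ℝ) : ℕ → Ω → UH ⊕ UR → ℝ
  | 0, _, _ => 0
  | t + 1, ω, u => max (H π γ t ω u - π.adm t ω u) 0 + γ t ω u

/-- The virtual queue of the energy efficiency constraint. -/
def Z (π : Policy N ν P) : ℕ → Ω → ℝ
  | 0, _ => 0
  | t + 1, ω => max (Z π t ω - π.μsum t ω) 0 + N.W * N.ηreq * π.psum t ω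

/-- All queues `χ(t)`. -/
def χ (π : Policy N ν P) (γ : ℕ → Ω → UH ⊕ UR → ℝ) (t : ℕ) (ω : Ω) :
    (UH ⊕ UR → ℝ) × (UH ⊕ UR → ℝ) × ℝ :=
  (π.Q t ω, π.H γ t ω, π.Z t ω)

/-- Average expected throughputs over the first `T` slots. -/
def avgAdm (π : Policy N ν P) (T : ℕ) (u : UH ⊕ UR) : ℝ :=
  (∑ t ∈ Finset.range T, ∫ ω, π.adm t ω u ∂P) / T

/-- Energy efficiency over the first `T` slots. -/
def EE (π : Policy N ν P) (T : ℕ) : ℝ :=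
  ((∑ t ∈ Finset.range T, ∫ ω, π.μsum t ω ∂P) / T)
    / (N.W * ((∑ t ∈ Finset.range T, ∫ ω, π.psum t ω ∂P) / T))

/-- All traffic queues are strongly stable. -/
def StronglyStable (π : Policy N ν P) : Prop :=
  ∀ u, limsup (fun T : ℕ => (((∑ t ∈ Finset.range T, ∫ ω, π.Q t ω u ∂P) / T : ℝ) : EReal)) atTop < ⊤

/-- The long-term energy efficiency is at least the required one. -/
def MeetsEE (π : Policy N ν P) : Prop :=
  (N.ηreq : EReal) ≤ liminf (fun T : ℕ => (π.EE T : EReal)) atTop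

/-- Admissible auxiliary variables of a policy. -/
structure IsAux (π : Policy N ν P) (γ : ℕ → Ω → UH ⊕ UR → ℝ) : Prop where
  meas : ∀ t, Measurable[π.info (t + 1)] (γ t)
  mem : ∀ t, ∀ᵐ ω ∂P, ∀ u, 0 ≤ γ t ω u ∧ γ t ω u ≤ N.Amax u

/-- The quadratic term of the drift bound in slot `t`. -/
def driftTerm (π : Policy N ν P) (γ : ℕ → Ω → UH ⊕ UR → ℝ) (t : ℕ) (ω : Ω) : ℝ :=
  (1 / 2) * ((N.W * N.ηreq * π.psum t ω) ^ 2 + π.μsum t ω ^ 2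
    + ∑ u, (2 * π.adm t ω u ^ 2 + π.μ t ω u ^ 2 * N.τ ^ 2 + γ t ω u ^ 2))

/-- The policy `π` with auxiliary variables `γ` is the drift-plus-penalty algorithm with control
parameter `V`: in each slot it observes the queues and the network state and chooses

* auxiliary variables maximizing `V α g_R(γⱼ) - Hⱼ γⱼ` (resp. `V β g_H(γₘ) - Hₘ γₘ`) on `[0, Amax]`,
* the threshold admission: admit all the arrivals of a user if `H - Q > 0`, and nothing otherwise,
* a feasible allocation minimizing the allocation objective. -/
structure IsDriftPlusPenalty (V : ℝ) (π : Policy N ν P) (γ : ℕ → Ω → UH ⊕ UR → ℝ) : Prop where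
  aux : π.IsAux γ
  aux_opt : ∀ t, ∀ᵐ ω ∂P, ∀ u, IsMaxOn
    (fun y : ℝ => (V : EReal) * userUtility N u y - ((π.H γ t ω u * y : ℝ) : EReal))
    (Icc 0 (N.Amax u)) (γ t ω u)
  adm_opt : ∀ t, ∀ᵐ ω ∂P, ∀ u,
    (0 < π.H γ t ω u - π.Q t ω u → π.adm t ω u = (π.state t ω).2 u) ∧
    (¬ 0 < π.H γ t ω u - π.Q t ω u → π.adm t ω u = 0)
  dec_opt : ∀ t, ∀ᵐ ω ∂P, IsMinOn
    (allocObjective N (π.Q t ω) (π.Z t ω) (π.state t ω).1) {d | Feasible N d} (π.dec t ω)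

end Policy

/-- `C` bounds the conditional expectation of the quadratic term of the drift bound given the
queues, in every slot, for every policy and all admissible auxiliary variables. -/
def IsDriftConstant (N : Network RRH UH UR KR KH S) (ν : Measure (S × (UH ⊕ UR → ℝ))) (C : ℝ) :
    Prop :=
  ∀ (Ω : Type) [MeasurableSpace Ω] (P : Measure Ω) [IsProbabilityMeasure P] (π : Policy N ν P)
    (γ : ℕ → Ω → UH ⊕ UR → ℝ), π.IsAux γ → ∀ t,
    ∀ᵐ ω ∂P, (P[π.driftTerm γ t | MeasurableSpace.comap (π.χ γ t) inferInstance]) ω ≤ C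

/-- The optimal infinite horizon utility over all policies that strongly stabilize the traffic
queues and meet the energy efficiency requirement. A policy whose average throughputs do not
converge is credited with its upper limit. -/
def optimalUtility (N : Network RRH UH UR KR KH S) (ν : Measure (S × (UH ⊕ UR → ℝ))) : EReal :=
  sSup {v | ∃ (Ω : Type) (_ : MeasurableSpace Ω) (P : Measure Ω) (_ : IsProbabilityMeasure P)
    (π : Policy N ν P), π.StronglyStable ∧ π.MeetsEE ∧
      v = limsup (fun T : ℕ => utility N (π.avgAdm T)) atTop}

end Dynamics

end HCRAN

end

/-! This is the Lyapunov drift argument. With L half the sum of the squares of all queues, squaring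
the queue recursions bounds one slot's increase of L by the quadratic term, whose expectation is at
most C, plus a cost linear in the queues: `slotCost`, which depends on admissions and allocation,
and ∑ H γ. The algorithm minimizes `slotCost` for the current queues and state, and its auxiliary
variables satisfy V φ(r) - H r ≤ V φ(γ) - H γ for every r of finite utility φ(r) in the box.

The comparison with an arbitrary policy uses no stationary randomized policy and no convexity of the
rate region. What is needed of throughputs r is a family of inequalities, `DualAchievable`: for each
fixed non-negative weight vector (q, h, z), the expected minimal slot cost is at most -∑ h r. Every
limit point r of the average throughputs of a stable policy meeting the efficiency requirement has
this property (`dualAchievable_of_tendsto`): no policy beats the minimum in any slot, and in the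
time average the q and z terms disappear or have the right sign. For the algorithm the weights are
the queues, which are independent of the current state; integrating the inequalities over their law
gives E[slotCost] ≤ -∑ E[H] r (`IsDriftPlusPenalty.integral_slotCost_le`).

The terms H r now cancel and the drift telescopes to E L(T) ≤ T (C - V U(r)) + V ∑ E φ(γ)
(`IsDriftPlusPenalty.integral_lyapunov_le`). This is used twice. Since L ≥ 0, the averages of E φ(γ)
sum to at least U(r) - C/V, and Jensen carries this to U of the average γ. Since φ(γ) is bounded
above, E L grows at most linearly, so E H(T)/T → 0 and average admissions asymptotically dominate
average γ; monotonicity of U concludes. Limits are taken along ultrafilters in the compact box of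
throughputs, where U is continuous into `EReal`. -/

noncomputable section

namespace HCRAN

set_option linter.unusedSectionVars false

/-! ### Bounds for a single slot and the minimal slot cost. -/

section SlotBounds

variable {RRH UH UR KR KH S : Type*} [Fintype RRH] [Fintype UH] [Fintype UR] [Fintype KR]
  [Fintype KH] {N : Network RRH UH UR KR KH S} {d : Decision RRH UH UR KR KH}

lemma rateSum_eq_sum_rate (N : Network RRH UH UR KR KH S) (x : S)
    (d : Decision RRH UH UR KR KH) : rateSum N x d = ∑ u, rate N x d u := by
  simp [rateSum, rate, Fintype.sum_sum_type]

lemma nonneg_of_binary {a : ℝ} (h : a = 0 ∨ a = 1) : 0 ≤ a := by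
  rcases h with h | h <;> simp [h]

lemma one_sub_nonneg_of_binary {a : ℝ} (h : a = 0 ∨ a = 1) : 0 ≤ 1 - a := by
  rcases h with h | h <;> simp [h]

namespace Feasible

lemma powerR_terms_nonneg (h : Feasible N d) (i : RRH) :
    (∀ j k, 0 ≤ d.aR j k * d.pR i j k) ∧ ∀ m k, 0 ≤ d.s m * d.aH m k * d.pH i m k :=
  ⟨fun j k => mul_nonneg (nonneg_of_binary (h.aR_binary j k)) (h.pR_nonneg i j k),
   fun m k => mul_nonneg (mul_nonneg (nonneg_of_binary (h.s_binary m))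
    (nonneg_of_binary (h.aH_binary m k))) (h.pH_nonneg i m k)⟩

lemma powerH_terms_nonneg (h : Feasible N d) (m : UH) (l : KH) :
    0 ≤ (1 - d.s m) * (d.b m l * d.pM m l) :=
  mul_nonneg (one_sub_nonneg_of_binary (h.s_binary m))
    (mul_nonneg (nonneg_of_binary (h.b_binary m l)) (h.pM_nonneg m l))

lemma powerR_nonneg (h : Feasible N d) (i : RRH) : 0 ≤ powerR d i := by
  obtain ⟨h1, h2⟩ := h.powerR_terms_nonneg i
  exact add_nonneg (Finset.sum_nonneg fun j _ => Finset.sum_nonneg fun k _ => h1 j k)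
    (Finset.sum_nonneg fun m _ => Finset.sum_nonneg fun k _ => h2 m k)

lemma powerH_nonneg (h : Feasible N d) : 0 ≤ powerH d :=
  Finset.sum_nonneg fun m _ => Finset.sum_nonneg fun l _ => h.powerH_terms_nonneg m l

lemma aR_mul_pR_le (h : Feasible N d) (i : RRH) (j : UR) (k : KR) :
    d.aR j k * d.pR i j k ≤ N.pmaxR i := by
  obtain ⟨h1, h2⟩ := h.powerR_terms_nonneg i
  refine le_trans ?_ (h.powerR_le i)
  refine le_trans ?_ (le_add_of_nonneg_right
    (Finset.sum_nonneg fun m _ => Finset.sum_nonneg fun k _ => h2 m k))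
  exact (Finset.single_le_sum (f := fun k => d.aR j k * d.pR i j k) (fun k _ => h1 j k)
    (Finset.mem_univ k)).trans
    (Finset.single_le_sum (f := fun j => ∑ k, d.aR j k * d.pR i j k)
      (fun j _ => Finset.sum_nonneg fun k _ => h1 j k) (Finset.mem_univ j))

lemma s_mul_aH_mul_pH_le (h : Feasible N d) (i : RRH) (m : UH) (k : KR) :
    d.s m * d.aH m k * d.pH i m k ≤ N.pmaxR i := by
  obtain ⟨h1, h2⟩ := h.powerR_terms_nonneg i
  refine le_trans ?_ (h.powerR_le i)
  refine le_trans ?_ (le_add_of_nonneg_left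
    (Finset.sum_nonneg fun j _ => Finset.sum_nonneg fun k _ => h1 j k))
  exact (Finset.single_le_sum (f := fun k => d.s m * d.aH m k * d.pH i m k) (fun k _ => h2 m k)
    (Finset.mem_univ k)).trans
    (Finset.single_le_sum (f := fun m => ∑ k, d.s m * d.aH m k * d.pH i m k)
      (fun m _ => Finset.sum_nonneg fun k _ => h2 m k) (Finset.mem_univ m))

lemma one_sub_s_mul_b_mul_pM_le (h : Feasible N d) (m : UH) (l : KH) :
    (1 - d.s m) * (d.b m l * d.pM m l) ≤ N.pmaxH := by
  refine le_trans ?_ h.powerH_le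
  exact (Finset.single_le_sum (f := fun l => (1 - d.s m) * (d.b m l * d.pM m l))
      (fun l _ => h.powerH_terms_nonneg m l) (Finset.mem_univ l)).trans
    (Finset.single_le_sum (f := fun m => ∑ l, (1 - d.s m) * (d.b m l * d.pM m l))
      (fun m _ => Finset.sum_nonneg fun l _ => h.powerH_terms_nonneg m l) (Finset.mem_univ m))

end Feasible

lemma blockRate_nonneg (N : Network RRH UH UR KR KH S) {y : ℝ} (hy : 0 ≤ y) :
    0 ≤ N.W₀ * Real.logb 2 (1 + y) :=
  mul_nonneg N.W₀_pos.le (Real.logb_nonneg (by norm_num) (by linarith))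

lemma blockRate_mono (N : Network RRH UH UR KR KH S) {y z : ℝ} (hy : 0 ≤ y) (hyz : y ≤ z) :
    N.W₀ * Real.logb 2 (1 + y) ≤ N.W₀ * Real.logb 2 (1 + z) :=
  mul_le_mul_of_nonneg_left
    (Real.logb_le_logb_of_le (by norm_num) (by linarith) (by linarith)) N.W₀_pos.le

namespace Feasible

/-- Feasibility does not limit a power whose indicator is 0, but such a block carries no rate; once
the indicator is 1, the limit of the RRH applies to the power itself. -/
lemma rateR_mem (h : Feasible N d) (x : S) (j : UR) :
    0 ≤ rateR N x d j ∧ rateR N x d j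
      ≤ ∑ k, N.W₀ * Real.logb 2 (1 + ∑ i, N.pmaxR i * N.gainR x i j k) := by
  have hS : ∀ k, 0 ≤ ∑ i, d.pR i j k * N.gainR x i j k := fun k =>
    Finset.sum_nonneg fun i _ => mul_nonneg (h.pR_nonneg i j k) (N.gainR_nonneg x i j k)
  have hM : ∀ k, 0 ≤ ∑ i, N.pmaxR i * N.gainR x i j k := fun k =>
    Finset.sum_nonneg fun i _ => mul_nonneg (N.pmaxR_nonneg i) (N.gainR_nonneg x i j k)
  refine ⟨Finset.sum_nonneg fun k _ => mul_nonneg (nonneg_of_binary (h.aR_binary j k))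
    (blockRate_nonneg N (hS k)), Finset.sum_le_sum fun k _ => ?_⟩
  rcases h.aR_binary j k with ha | ha
  · rw [ha, zero_mul]
    exact blockRate_nonneg N (hM k)
  · rw [ha, one_mul]
    refine blockRate_mono N (hS k) (Finset.sum_le_sum fun i _ =>
      mul_le_mul_of_nonneg_right ?_ (N.gainR_nonneg x i j k))
    simpa [ha] using h.aR_mul_pR_le i j k

lemma rateH_mem (h : Feasible N d) (x : S) (m : UH) :
    0 ≤ rateH N x d m ∧ rateH N x d m
      ≤ ∑ l, N.W₀ * Real.logb 2 (1 + N.gainM x m l * N.pmaxH)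
        + ∑ k, N.W₀ * Real.logb 2 (1 + ∑ i, N.pmaxR i * N.gainH x i m k) := by
  have hS : ∀ k, 0 ≤ ∑ i, d.pH i m k * N.gainH x i m k := fun k =>
    Finset.sum_nonneg fun i _ => mul_nonneg (h.pH_nonneg i m k) (N.gainH_nonneg x i m k)
  have hM : ∀ k, 0 ≤ ∑ i, N.pmaxR i * N.gainH x i m k := fun k =>
    Finset.sum_nonneg fun i _ => mul_nonneg (N.pmaxR_nonneg i) (N.gainH_nonneg x i m k)
  have hS' : ∀ l, 0 ≤ N.gainM x m l * d.pM m l := fun l =>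
    mul_nonneg (N.gainM_nonneg x m l) (h.pM_nonneg m l)
  have hM' : ∀ l, 0 ≤ N.gainM x m l * N.pmaxH := fun l =>
    mul_nonneg (N.gainM_nonneg x m l) N.pmaxH_nonneg
  have h1 : ∀ l, 0 ≤ d.b m l * (N.W₀ * Real.logb 2 (1 + N.gainM x m l * d.pM m l)) := fun l =>
    mul_nonneg (nonneg_of_binary (h.b_binary m l)) (blockRate_nonneg N (hS' l))
  have h2 : ∀ k, 0 ≤ d.aH m k *
      (N.W₀ * Real.logb 2 (1 + ∑ i, d.pH i m k * N.gainH x i m k)) := fun k =>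
    mul_nonneg (nonneg_of_binary (h.aH_binary m k)) (blockRate_nonneg N (hS k))
  have h3 := Finset.sum_nonneg fun l (_ : l ∈ Finset.univ) => blockRate_nonneg N (hM' l)
  have h4 := Finset.sum_nonneg fun k (_ : k ∈ Finset.univ) => blockRate_nonneg N (hM k)
  have h5 := Finset.sum_nonneg fun l (_ : l ∈ Finset.univ) => h1 l
  have h6 := Finset.sum_nonneg fun k (_ : k ∈ Finset.univ) => h2 k
  unfold rateH
  rcases h.s_binary m with hs | hs
  · simp only [hs, sub_zero, one_mul, zero_mul, add_zero]
    refine ⟨h5, le_add_of_le_of_nonneg (Finset.sum_le_sum fun l _ => ?_) h4⟩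
    rcases h.b_binary m l with hb | hb
    · rw [hb, zero_mul]
      exact blockRate_nonneg N (hM' l)
    · rw [hb, one_mul]
      refine blockRate_mono N (hS' l) (mul_le_mul_of_nonneg_left ?_ (N.gainM_nonneg x m l))
      simpa [hs, hb] using h.one_sub_s_mul_b_mul_pM_le m l
  · simp only [hs, sub_self, one_mul, zero_mul, zero_add]
    refine ⟨h6, le_add_of_nonneg_of_le h3 (Finset.sum_le_sum fun k _ => ?_)⟩
    rcases h.aH_binary m k with ha | ha
    · rw [ha, zero_mul]
      exact blockRate_nonneg N (hM k)
    · rw [ha, one_mul]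
      refine blockRate_mono N (hS k) (Finset.sum_le_sum fun i _ =>
        mul_le_mul_of_nonneg_right ?_ (N.gainH_nonneg x i m k))
      simpa [ha, hs] using h.s_mul_aH_mul_pH_le i m k

lemma rate_nonneg (h : Feasible N d) (x : S) (u : UH ⊕ UR) : 0 ≤ rate N x d u := by
  rcases u with m | j
  · exact (h.rateH_mem x m).1
  · exact (h.rateR_mem x j).1

/-- Positive static power keeps the denominator of the energy efficiency away from 0. -/
lemma static_le_powerSum (h : Feasible N d) : N.pcR + N.pcH ≤ powerSum N d := by
  have h1 : 0 ≤ ∑ i, N.effR * powerR d i :=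
    Finset.sum_nonneg fun i _ => mul_nonneg N.effR_pos.le (h.powerR_nonneg i)
  have h2 : 0 ≤ N.effH * powerH d := mul_nonneg N.effH_pos.le h.powerH_nonneg
  unfold powerSum
  linarith

end Feasible

/-- The largest possible total power consumption. -/
def powerMax (N : Network RRH UH UR KR KH S) : ℝ :=
  ∑ i, N.effR * N.pmaxR i + N.pcR + N.effH * N.pmaxH + N.pcH

lemma Feasible.powerSum_le (h : Feasible N d) : powerSum N d ≤ powerMax N := by
  have h1 : ∑ i, N.effR * powerR d i ≤ ∑ i, N.effR * N.pmaxR i :=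
    Finset.sum_le_sum fun i _ => mul_le_mul_of_nonneg_left (h.powerR_le i) N.effR_pos.le
  have h2 := mul_le_mul_of_nonneg_left h.powerH_le N.effH_pos.le
  unfold powerSum powerMax
  linarith

lemma Feasible.powerSum_nonneg (h : Feasible N d) : 0 ≤ powerSum N d :=
  N.pc_pos.le.trans h.static_le_powerSum

/-- Finiteness of the channel state space makes the state-dependent bounds uniform. -/
lemma exists_rate_le [Finite S] (N : Network RRH UH UR KR KH S) :
    ∃ M : ℝ, 0 ≤ M ∧ ∀ x (d : Decision RRH UH UR KR KH), Feasible N d → ∀ u,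
      rate N x d u ≤ M := by
  let f : S × (UH ⊕ UR) → ℝ := fun y => Sum.elim
    (fun m => ∑ l, N.W₀ * Real.logb 2 (1 + N.gainM y.1 m l * N.pmaxH)
        + ∑ k, N.W₀ * Real.logb 2 (1 + ∑ i, N.pmaxR i * N.gainH y.1 i m k))
    (fun j => ∑ k, N.W₀ * Real.logb 2 (1 + ∑ i, N.pmaxR i * N.gainR y.1 i j k)) y.2
  obtain ⟨M, hM⟩ := (Set.finite_range f).bddAbove
  refine ⟨max M 0, le_max_right _ _, fun x d h u => le_max_of_le_left ?_⟩
  refine le_trans ?_ (hM ⟨(x, u), rfl⟩)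
  rcases u with m | j
  · exact (h.rateH_mem x m).2
  · exact (h.rateR_mem x j).2

/-- The decision that transmits nothing. -/
def idleDecision (RRH UH UR KR KH : Type*) : Decision RRH UH UR KR KH where
  s := 0
  aR := 0
  aH := 0
  b := 0
  pR := 0
  pH := 0
  pM := 0

lemma feasible_idleDecision (N : Network RRH UH UR KR KH S) :
    Feasible N (idleDecision RRH UH UR KR KH) := by
  constructor <;> simp [idleDecision, powerR, powerH, N.pmaxR_nonneg, N.pmaxH_nonneg]

instance (N : Network RRH UH UR KR KH S) :
    Nonempty {d : Decision RRH UH UR KR KH // Feasible N d} :=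
  ⟨⟨_, feasible_idleDecision N⟩⟩

/-- The part of the drift bound that depends on the allocation. -/
def allocCost (N : Network RRH UH UR KR KH S) (q : UH ⊕ UR → ℝ) (z : ℝ) (x : S)
    (d : Decision RRH UH UR KR KH) : ℝ :=
  z * (N.W * N.ηreq * powerSum N d) - ∑ u, (q u * N.τ + z) * rate N x d u

/-- The difference is the static power term, independent of the decision, so both functions have the
same minimizers. -/
lemma allocCost_eq (N : Network RRH UH UR KR KH S) (q : UH ⊕ UR → ℝ) (z : ℝ) (x : S)
    (d : Decision RRH UH UR KR KH) :
    allocCost N q z x d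
      = allocObjective N q z x d + z * (N.W * N.ηreq * (N.pcR + N.pcH)) := by
  simp only [allocCost, allocObjective, powerSum, rate, Fintype.sum_sum_type, Sum.elim_inl,
    Sum.elim_inr, ← Finset.mul_sum]
  ring

/-- The part of the drift bound that depends on the admissions and on the allocation. -/
def slotCost (N : Network RRH UH UR KR KH S) (c : (UH ⊕ UR → ℝ) × (UH ⊕ UR → ℝ) × ℝ) (x : S)
    (R : UH ⊕ UR → ℝ) (d : Decision RRH UH UR KR KH) : ℝ :=
  ∑ u, (c.1 u - c.2.1 u) * R u + allocCost N c.1 c.2.2 x d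

/-- The least value of `slotCost` over all admissions and feasible allocations. -/
def minSlotCost (N : Network RRH UH UR KR KH S) (c : (UH ⊕ UR → ℝ) × (UH ⊕ UR → ℝ) × ℝ)
    (y : S × (UH ⊕ UR → ℝ)) : ℝ :=
  ∑ u, min (c.1 u - c.2.1 u) 0 * y.2 u
    + ⨅ d : {d : Decision RRH UH UR KR KH // Feasible N d}, allocCost N c.1 c.2.2 y.1 d

variable [Finite S]

lemma exists_abs_allocCost_le (N : Network RRH UH UR KR KH S) (q : UH ⊕ UR → ℝ) (z : ℝ) :
    ∃ B, ∀ x (d : Decision RRH UH UR KR KH), Feasible N d → |allocCost N q z x d| ≤ B := by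
  obtain ⟨M, hM0, hM⟩ := exists_rate_le N
  refine ⟨|z| * (N.W * N.ηreq * powerMax N) + ∑ u, |q u * N.τ + z| * M, fun x d h => ?_⟩
  have hW : 0 ≤ N.W * N.ηreq := mul_nonneg N.W_pos.le N.ηreq_nonneg
  refine (abs_sub _ _).trans (add_le_add ?_ ?_)
  · rw [abs_mul, abs_of_nonneg (mul_nonneg hW h.powerSum_nonneg)]
    gcongr
    exact h.powerSum_le
  · refine (Finset.abs_sum_le_sum_abs _ _).trans (Finset.sum_le_sum fun u _ => ?_)
    rw [abs_mul, abs_of_nonneg (h.rate_nonneg x u)]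
    gcongr
    exact hM x d h u

lemma bddBelow_range_allocCost (N : Network RRH UH UR KR KH S) (q : UH ⊕ UR → ℝ) (z : ℝ) (x : S) :
    BddBelow (range fun d : {d : Decision RRH UH UR KR KH // Feasible N d} =>
      allocCost N q z x d) := by
  obtain ⟨B, hB⟩ := exists_abs_allocCost_le N q z
  exact ⟨-B, by rintro _ ⟨d, rfl⟩; exact (abs_le.1 (hB x d d.2)).1⟩

lemma minSlotCost_le (N : Network RRH UH UR KR KH S) (c : (UH ⊕ UR → ℝ) × (UH ⊕ UR → ℝ) × ℝ)
    (y : S × (UH ⊕ UR → ℝ)) {R : UH ⊕ UR → ℝ} (hR : ∀ u, 0 ≤ R u ∧ R u ≤ y.2 u)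
    (hd : Feasible N d) : minSlotCost N c y ≤ slotCost N c y.1 R d := by
  refine add_le_add (Finset.sum_le_sum fun u _ => ?_)
    (ciInf_le (bddBelow_range_allocCost N c.1 c.2.2 y.1) ⟨d, hd⟩)
  calc min (c.1 u - c.2.1 u) 0 * y.2 u
      ≤ min (c.1 u - c.2.1 u) 0 * R u :=
        mul_le_mul_of_nonpos_left (hR u).2 (min_le_right _ _)
    _ ≤ (c.1 u - c.2.1 u) * R u := mul_le_mul_of_nonneg_right (min_le_left _ _) (hR u).1

/-- The cost separates: each admission enters linearly with coefficient Q - H, so the threshold rule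
is optimal on [0, A], and the allocation is optimized on its own. -/
lemma minSlotCost_eq (N : Network RRH UH UR KR KH S) (c : (UH ⊕ UR → ℝ) × (UH ⊕ UR → ℝ) × ℝ)
    (y : S × (UH ⊕ UR → ℝ)) {R : UH ⊕ UR → ℝ}
    (hR : ∀ u, (0 < c.2.1 u - c.1 u → R u = y.2 u) ∧ (¬ 0 < c.2.1 u - c.1 u → R u = 0))
    (hd : Feasible N d)
    (hmin : IsMinOn (allocObjective N c.1 c.2.2 y.1) {d | Feasible N d} d) :
    minSlotCost N c y = slotCost N c y.1 R d := by
  unfold minSlotCost slotCost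
  congr 1
  · refine Finset.sum_congr rfl fun u _ => ?_
    by_cases h : 0 < c.2.1 u - c.1 u
    · rw [(hR u).1 h, min_eq_left (by linarith)]
    · rw [(hR u).2 h, min_eq_right (by linarith)]
      simp
  · refine le_antisymm (ciInf_le (bddBelow_range_allocCost N c.1 c.2.2 y.1) ⟨d, hd⟩)
      (le_ciInf fun d' => ?_)
    rw [allocCost_eq, allocCost_eq]
    have := hmin d'.2
    simp only [mem_ofPred_eq] at this
    linarith

lemma exists_abs_minSlotCost_le (N : Network RRH UH UR KR KH S)
    (c : (UH ⊕ UR → ℝ) × (UH ⊕ UR → ℝ) × ℝ) :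
    ∃ B, ∀ y : S × (UH ⊕ UR → ℝ), (∀ u, 0 ≤ y.2 u ∧ y.2 u ≤ N.Amax u) →
      |minSlotCost N c y| ≤ B := by
  obtain ⟨B, hB⟩ := exists_abs_allocCost_le N c.1 c.2.2
  refine ⟨∑ u, |min (c.1 u - c.2.1 u) 0| * N.Amax u + B, fun y hy => ?_⟩
  refine (abs_add_le _ _).trans (add_le_add ?_ ?_)
  · refine (Finset.abs_sum_le_sum_abs _ _).trans (Finset.sum_le_sum fun u _ => ?_)
    rw [abs_mul, abs_of_nonneg (hy u).1]
    gcongr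
    exact (hy u).2
  · refine abs_le.2 ⟨le_ciInf fun d => (abs_le.1 (hB y.1 d d.2)).1, ?_⟩
    exact (ciInf_le (bddBelow_range_allocCost N c.1 c.2.2 y.1) ⟨_, feasible_idleDecision N⟩).trans
      (abs_le.1 (hB y.1 _ (feasible_idleDecision N))).2

/-- The infimum runs over uncountably many decisions, but for fixed channel state each cost is
continuous in the queues, so the infimum is upper semicontinuous; the channel state takes only
finitely many values. -/
lemma measurable_minSlotCost [MeasurableSpace S] [MeasurableSingletonClass S]
    (N : Network RRH UH UR KR KH S) :
    Measurable fun p : ((UH ⊕ UR → ℝ) × (UH ⊕ UR → ℝ) × ℝ) × (S × (UH ⊕ UR → ℝ)) =>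
      minSlotCost N p.1 p.2 := by
  have h : Measurable fun p : ((UH ⊕ UR → ℝ) × (UH ⊕ UR → ℝ) × ℝ) × S =>
      ⨅ d : {d : Decision RRH UH UR KR KH // Feasible N d}, allocCost N p.1.1 p.1.2.2 p.2 d := by
    refine measurable_from_prod_countable_left fun x => UpperSemicontinuous.measurable ?_
    refine upperSemicontinuous_ciInf (fun c => bddBelow_range_allocCost N c.1 c.2.2 x)
      fun d => Continuous.upperSemicontinuous ?_
    unfold allocCost
    fun_prop
  have h' : Measurable fun p : ((UH ⊕ UR → ℝ) × (UH ⊕ UR → ℝ) × ℝ) × (S × (UH ⊕ UR → ℝ)) =>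
      ∑ u, min (p.1.1 u - p.1.2.1 u) 0 * p.2.2 u := by
    fun_prop
  exact h'.add (h.comp (f := fun p : ((UH ⊕ UR → ℝ) × (UH ⊕ UR → ℝ) × ℝ) × (S × (UH ⊕ UR → ℝ)) =>
    (p.1, p.2.1)) (by fun_prop))

end SlotBounds

/-! ### Essentially bounded random variables, a class that makes all integrability routine. -/

section EssBdd

variable {Ω : Type*} [MeasurableSpace Ω] {P : Measure Ω} {f g : Ω → ℝ}

/-- Measurable and almost surely bounded random variables. -/
def EssBdd (P : Measure Ω) (f : Ω → ℝ) : Prop :=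
  Measurable f ∧ ∃ c, ∀ᵐ ω ∂P, |f ω| ≤ c

namespace EssBdd

lemma of_mem {a b : ℝ} (hf : Measurable f) (h : ∀ᵐ ω ∂P, a ≤ f ω ∧ f ω ≤ b) : EssBdd P f := by
  refine ⟨hf, max |a| |b|, h.mono fun ω hω => ?_⟩
  exact abs_le_max_abs_abs hω.1 hω.2

lemma integrable [IsFiniteMeasure P] (hf : EssBdd P f) : Integrable f P := by
  obtain ⟨hm, c, hc⟩ := hf
  exact Integrable.of_bound hm.aestronglyMeasurable c hc

lemma const (c : ℝ) : EssBdd P (fun _ => c) :=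
  ⟨measurable_const, |c|, ae_of_all _ fun _ => le_rfl⟩

lemma add (hf : EssBdd P f) (hg : EssBdd P g) : EssBdd P (fun ω => f ω + g ω) := by
  obtain ⟨hf, c, hc⟩ := hf
  obtain ⟨hg, c', hc'⟩ := hg
  refine ⟨hf.add hg, c + c', ?_⟩
  filter_upwards [hc, hc'] with ω h h'
  exact (abs_add_le _ _).trans (add_le_add h h')

lemma mul (hf : EssBdd P f) (hg : EssBdd P g) : EssBdd P (fun ω => f ω * g ω) := by
  obtain ⟨hf, c, hc⟩ := hf
  obtain ⟨hg, c', hc'⟩ := hg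
  refine ⟨hf.mul hg, c * c', ?_⟩
  filter_upwards [hc, hc'] with ω h h'
  rw [abs_mul]
  exact mul_le_mul h h' (abs_nonneg _) ((abs_nonneg _).trans h)

lemma const_mul (c : ℝ) (hf : EssBdd P f) : EssBdd P (fun ω => c * f ω) :=
  (const c).mul hf

lemma mul_const (hf : EssBdd P f) (c : ℝ) : EssBdd P (fun ω => f ω * c) :=
  hf.mul (const c)

lemma sub (hf : EssBdd P f) (hg : EssBdd P g) : EssBdd P (fun ω => f ω - g ω) := by
  simpa [sub_eq_add_neg] using hf.add (hg.const_mul (-1))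

lemma sq (hf : EssBdd P f) : EssBdd P (fun ω => f ω ^ 2) := by
  simpa [pow_two] using hf.mul hf

lemma sum {ι : Type*} {s : Finset ι} {f : ι → Ω → ℝ} (hf : ∀ i, EssBdd P (f i)) :
    EssBdd P (fun ω => ∑ i ∈ s, f i ω) := by
  classical
  induction s using Finset.induction_on with
  | empty => simpa using const (P := P) 0
  | insert i s hi ih =>
    simp only [Finset.sum_insert hi]
    exact (hf i).add ih

end EssBdd

end EssBdd

/-! ### Measurability of powers and rates. -/

section Measurability

variable {RRH UH UR KR KH S : Type*}

lemma measurable_decision_tuple : Measurable fun d : Decision RRH UH UR KR KH =>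
    (d.s, d.aR, d.aH, d.b, d.pR, d.pH, d.pM) := comap_measurable _

lemma measurable_decision_s (m : UH) :
    Measurable fun d : Decision RRH UH UR KR KH => d.s m :=
  (measurable_pi_apply m).comp (measurable_decision_tuple.fst)

lemma measurable_decision_aR (j : UR) (k : KR) :
    Measurable fun d : Decision RRH UH UR KR KH => d.aR j k :=
  (measurable_pi_apply k).comp ((measurable_pi_apply j).comp measurable_decision_tuple.snd.fst)

lemma measurable_decision_aH (m : UH) (k : KR) :
    Measurable fun d : Decision RRH UH UR KR KH => d.aH m k :=
  (measurable_pi_apply k).comp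
    ((measurable_pi_apply m).comp measurable_decision_tuple.snd.snd.fst)

lemma measurable_decision_b (m : UH) (l : KH) :
    Measurable fun d : Decision RRH UH UR KR KH => d.b m l :=
  (measurable_pi_apply l).comp
    ((measurable_pi_apply m).comp measurable_decision_tuple.snd.snd.snd.fst)

lemma measurable_decision_pR (i : RRH) (j : UR) (k : KR) :
    Measurable fun d : Decision RRH UH UR KR KH => d.pR i j k :=
  (measurable_pi_apply k).comp ((measurable_pi_apply j).comp
    ((measurable_pi_apply i).comp measurable_decision_tuple.snd.snd.snd.snd.fst))

lemma measurable_decision_pH (i : RRH) (m : UH) (k : KR) :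
    Measurable fun d : Decision RRH UH UR KR KH => d.pH i m k :=
  (measurable_pi_apply k).comp ((measurable_pi_apply m).comp
    ((measurable_pi_apply i).comp measurable_decision_tuple.snd.snd.snd.snd.snd.fst))

lemma measurable_decision_pM (m : UH) (l : KH) :
    Measurable fun d : Decision RRH UH UR KR KH => d.pM m l :=
  (measurable_pi_apply l).comp
    ((measurable_pi_apply m).comp measurable_decision_tuple.snd.snd.snd.snd.snd.snd)

attribute [local fun_prop] measurable_decision_s measurable_decision_aR measurable_decision_aH
  measurable_decision_b measurable_decision_pR measurable_decision_pH measurable_decision_pM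

variable [Fintype RRH] [Fintype UH] [Fintype UR] [Fintype KR] [Fintype KH]

lemma measurable_powerSum (N : Network RRH UH UR KR KH S) :
    Measurable fun d : Decision RRH UH UR KR KH => powerSum N d := by
  unfold powerSum powerR powerH
  fun_prop

lemma measurable_rate [Finite S] [MeasurableSpace S] [MeasurableSingletonClass S]
    (N : Network RRH UH UR KR KH S) (u : UH ⊕ UR) :
    Measurable fun p : S × Decision RRH UH UR KR KH => rate N p.1 p.2 u := by
  refine measurable_from_prod_countable_right fun x => ?_
  rcases u with m | j
  · simp only [rate, Sum.elim_inl, rateH, Real.logb]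
    fun_prop
  · simp only [rate, Sum.elim_inr, rateR, Real.logb]
    fun_prop

end Measurability

/-! ### Sample paths of a policy: adaptedness, boundedness, and the drift constant. -/

namespace Policy

variable {RRH UH UR KR KH S : Type*} [Fintype RRH] [Fintype UH] [Fintype UR] [Fintype KR]
  [Fintype KH] [MeasurableSpace S] {Ω : Type} [mΩ : MeasurableSpace Ω]
  {N : Network RRH UH UR KR KH S} {ν : Measure (S × (UH ⊕ UR → ℝ))} {P : Measure Ω}
  {γ : ℕ → Ω → UH ⊕ UR → ℝ}

lemma μsum_eq (π : Policy N ν P) (t : ℕ) (ω : Ω) : π.μsum t ω = ∑ u, π.μ t ω u :=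
  rateSum_eq_sum_rate N _ _

/-- The sample paths that respect all the constraints. -/
def Regular (π : Policy N ν P) (ω : Ω) : Prop :=
  ∀ t, (∀ u, 0 ≤ π.adm t ω u ∧ π.adm t ω u ≤ (π.state t ω).2 u) ∧ Feasible N (π.dec t ω) ∧
    ∀ u, 0 ≤ (π.state t ω).2 u ∧ (π.state t ω).2 u ≤ N.Amax u

lemma measurable_state (π : Policy N ν P) (t : ℕ) : Measurable (π.state t) :=
  (π.state_meas t).mono (π.info.le _) le_rfl

lemma ae_regular (hν : ∀ᵐ x ∂ν, ∀ u, 0 ≤ x.2 u ∧ x.2 u ≤ N.Amax u) (π : Policy N ν P) :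
    ∀ᵐ ω ∂P, π.Regular ω := by
  refine ae_all_iff.2 fun t => ?_
  have h := hν
  rw [← π.state_law t] at h
  filter_upwards [π.adm_mem t, π.dec_feasible t,
    ae_of_ae_map (π.measurable_state t).aemeasurable h] with ω h1 h2 h3
  exact ⟨h1, h2, h3⟩

/-- The sample paths along which the auxiliary variables are admissible. -/
def RegularAux (N : Network RRH UH UR KR KH S) (γ : ℕ → Ω → UH ⊕ UR → ℝ) (ω : Ω) : Prop :=
  ∀ t u, 0 ≤ γ t ω u ∧ γ t ω u ≤ N.Amax u

lemma IsAux.ae_regularAux {π : Policy N ν P} (h : π.IsAux γ) :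
    ∀ᵐ ω ∂P, RegularAux N γ ω :=
  ae_all_iff.2 h.mem

section Paths

variable {π : Policy N ν P} {ω : Ω}

lemma Regular.adm_mem (h : π.Regular ω) (t : ℕ) (u : UH ⊕ UR) :
    0 ≤ π.adm t ω u ∧ π.adm t ω u ≤ N.Amax u :=
  ⟨((h t).1 u).1, ((h t).1 u).2.trans ((h t).2.2 u).2⟩

lemma Regular.μ_nonneg (h : π.Regular ω) (t : ℕ) (u : UH ⊕ UR) : 0 ≤ π.μ t ω u :=
  (h t).2.1.rate_nonneg _ _

lemma Regular.μsum_nonneg (h : π.Regular ω) (t : ℕ) : 0 ≤ π.μsum t ω := by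
  rw [μsum_eq]
  exact Finset.sum_nonneg fun u _ => h.μ_nonneg t u

lemma Regular.psum_nonneg (h : π.Regular ω) (t : ℕ) : 0 ≤ π.psum t ω :=
  (h t).2.1.powerSum_nonneg

lemma W_mul_ηreq_nonneg (N : Network RRH UH UR KR KH S) : 0 ≤ N.W * N.ηreq :=
  mul_nonneg N.W_pos.le N.ηreq_nonneg

/-- The linear upper bound holds for every policy and says nothing about stability; it gives
integrability in each slot. -/
lemma Regular.Q_mem (h : π.Regular ω) (t : ℕ) (u : UH ⊕ UR) :
    0 ≤ π.Q t ω u ∧ π.Q t ω u ≤ t * N.Amax u := by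
  induction t with
  | zero => simp [Q]
  | succ t ih =>
    have h1 := h.adm_mem t u
    have h2 := mul_nonneg (h.μ_nonneg t u) N.τ_pos.le
    simp only [Q]
    refine ⟨add_nonneg (le_max_right _ _) h1.1, ?_⟩
    have : max (π.Q t ω u - π.μ t ω u * N.τ) 0 ≤ t * N.Amax u :=
      max_le (by linarith) (ih.1.trans ih.2)
    push_cast
    linarith

lemma Regular.H_mem (h : π.Regular ω) (hγ : RegularAux N γ ω) (t : ℕ) (u : UH ⊕ UR) :
    0 ≤ π.H γ t ω u ∧ π.H γ t ω u ≤ t * N.Amax u := by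
  induction t with
  | zero => simp [H]
  | succ t ih =>
    have h1 := h.adm_mem t u
    have h2 := hγ t u
    simp only [H]
    refine ⟨add_nonneg (le_max_right _ _) h2.1, ?_⟩
    have : max (π.H γ t ω u - π.adm t ω u) 0 ≤ t * N.Amax u :=
      max_le (by linarith) (ih.1.trans ih.2)
    push_cast
    linarith

lemma Regular.Z_mem (h : π.Regular ω) (t : ℕ) :
    0 ≤ π.Z t ω ∧ π.Z t ω ≤ t * (N.W * N.ηreq * powerMax N) := by
  induction t with
  | zero => simp [Z]
  | succ t ih =>
    have h1 := mul_nonneg (W_mul_ηreq_nonneg N) (h.psum_nonneg t)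
    have h2 := mul_le_mul_of_nonneg_left (h t).2.1.powerSum_le (W_mul_ηreq_nonneg N)
    have h3 := h.μsum_nonneg t
    simp only [Z]
    refine ⟨add_nonneg (le_max_right _ _) h1, ?_⟩
    have : max (π.Z t ω - π.μsum t ω) 0 ≤ t * (N.W * N.ηreq * powerMax N) :=
      max_le (by linarith) (ih.1.trans ih.2)
    push_cast
    simp only [psum] at h2 ⊢
    linarith

end Paths

lemma measurable_adm (π : Policy N ν P) (t : ℕ) (u : UH ⊕ UR) :
    Measurable[π.info (t + 1)] fun ω => π.adm t ω u :=
  (measurable_pi_apply u).comp (π.adm_meas t)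

lemma measurable_psum (π : Policy N ν P) (t : ℕ) : Measurable[π.info (t + 1)] (π.psum t) :=
  (measurable_powerSum N).comp (π.dec_meas t)

section

variable [Finite S] [MeasurableSingletonClass S]

lemma measurable_μ (π : Policy N ν P) (t : ℕ) (u : UH ⊕ UR) :
    Measurable[π.info (t + 1)] fun ω => π.μ t ω u :=
  (measurable_rate N u).comp ((π.state_meas t).fst.prodMk (π.dec_meas t))

lemma measurable_μsum (π : Policy N ν P) (t : ℕ) : Measurable[π.info (t + 1)] (π.μsum t) := by
  have : π.μsum t = fun ω => ∑ u, π.μ t ω u := funext fun ω => π.μsum_eq t ω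
  rw [this]
  exact Finset.measurable_fun_sum _ fun u _ => π.measurable_μ t u

lemma measurable_Q (π : Policy N ν P) (t : ℕ) (u : UH ⊕ UR) :
    Measurable[π.info t] fun ω => π.Q t ω u := by
  induction t with
  | zero => exact measurable_const
  | succ t ih =>
    have h1 := ih.mono (π.info.mono t.le_succ) le_rfl
    exact ((h1.sub ((π.measurable_μ t u).mul_const _)).max measurable_const).add
      (π.measurable_adm t u)

lemma measurable_H {π : Policy N ν P} (hγ : π.IsAux γ) (t : ℕ) (u : UH ⊕ UR) :
    Measurable[π.info t] fun ω => π.H γ t ω u := by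
  induction t with
  | zero => exact measurable_const
  | succ t ih =>
    have h1 := ih.mono (π.info.mono t.le_succ) le_rfl
    exact ((h1.sub (π.measurable_adm t u)).max measurable_const).add
      ((measurable_pi_apply u).comp (hγ.meas t))

lemma measurable_Z (π : Policy N ν P) (t : ℕ) : Measurable[π.info t] (π.Z t) := by
  induction t with
  | zero => exact measurable_const
  | succ t ih =>
    have h1 := ih.mono (π.info.mono t.le_succ) le_rfl
    exact ((h1.sub (π.measurable_μsum t)).max measurable_const).add
      ((π.measurable_psum t).const_mul _)

/-- The queues at `t` are determined before the state of slot `t` is revealed; this is the source of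
their independence. -/
lemma measurable_χ {π : Policy N ν P} (hγ : π.IsAux γ) (t : ℕ) :
    Measurable[π.info t] (π.χ γ t) :=
  Measurable.prodMk (@measurable_pi_lambda _ _ _ (π.info t) _ _ fun u => π.measurable_Q t u)
    (Measurable.prodMk (@measurable_pi_lambda _ _ _ (π.info t) _ _ fun u => measurable_H hγ t u)
      (π.measurable_Z t))

end

section Bounds

variable (hν : ∀ᵐ x ∂ν, ∀ u, 0 ≤ x.2 u ∧ x.2 u ≤ N.Amax u)
include hν

lemma essBdd_adm (π : Policy N ν P) (t : ℕ) (u : UH ⊕ UR) :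
    EssBdd P fun ω => π.adm t ω u :=
  .of_mem ((π.measurable_adm t u).mono (π.info.le _) le_rfl)
    ((π.ae_regular hν).mono fun _ h => h.adm_mem t u)

lemma essBdd_psum (π : Policy N ν P) (t : ℕ) : EssBdd P (π.psum t) :=
  .of_mem ((π.measurable_psum t).mono (π.info.le _) le_rfl)
    ((π.ae_regular hν).mono fun _ h => ⟨h.psum_nonneg t, (h t).2.1.powerSum_le⟩)

variable [Finite S] [MeasurableSingletonClass S]

lemma essBdd_μ (π : Policy N ν P) (t : ℕ) (u : UH ⊕ UR) : EssBdd P fun ω => π.μ t ω u := by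
  obtain ⟨M, -, hM⟩ := exists_rate_le N
  exact .of_mem ((π.measurable_μ t u).mono (π.info.le _) le_rfl)
    ((π.ae_regular hν).mono fun _ h => ⟨h.μ_nonneg t u, hM _ _ (h t).2.1 u⟩)

lemma essBdd_μsum (π : Policy N ν P) (t : ℕ) : EssBdd P (π.μsum t) := by
  have : π.μsum t = fun ω => ∑ u, π.μ t ω u := funext fun ω => π.μsum_eq t ω
  rw [this]
  exact .sum fun u => π.essBdd_μ hν t u

lemma essBdd_Q (π : Policy N ν P) (t : ℕ) (u : UH ⊕ UR) : EssBdd P fun ω => π.Q t ω u :=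
  .of_mem ((π.measurable_Q t u).mono (π.info.le _) le_rfl)
    ((π.ae_regular hν).mono fun _ h => h.Q_mem t u)

lemma essBdd_Z (π : Policy N ν P) (t : ℕ) : EssBdd P (π.Z t) :=
  .of_mem ((π.measurable_Z t).mono (π.info.le _) le_rfl)
    ((π.ae_regular hν).mono fun _ h => h.Z_mem t)

lemma essBdd_H {π : Policy N ν P} (hγ : π.IsAux γ) (t : ℕ) (u : UH ⊕ UR) :
    EssBdd P fun ω => π.H γ t ω u :=
  .of_mem ((measurable_H hγ t u).mono (π.info.le _) le_rfl) (by
    filter_upwards [π.ae_regular hν, hγ.ae_regularAux] with ω h h'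
    exact h.H_mem h' t u)

omit hν [Finite S] [MeasurableSingletonClass S] in
lemma essBdd_aux {π : Policy N ν P} (hγ : π.IsAux γ) (t : ℕ) (u : UH ⊕ UR) :
    EssBdd P fun ω => γ t ω u :=
  .of_mem (((measurable_pi_apply u).comp (hγ.meas t)).mono (π.info.le _) le_rfl)
    (hγ.ae_regularAux.mono fun _ h => h t u)

lemma essBdd_driftTerm {π : Policy N ν P} (hγ : π.IsAux γ) (t : ℕ) :
    EssBdd P (π.driftTerm γ t) :=
  .const_mul _ ((((π.essBdd_psum hν t).const_mul _).sq.add (π.essBdd_μsum hν t).sq).add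
    (.sum fun u => (((π.essBdd_adm hν t u).sq.const_mul _).add
      ((π.essBdd_μ hν t u).sq.mul_const _)).add (essBdd_aux hγ t u).sq))

end Bounds

variable [Finite S] [MeasurableSingletonClass S]

lemma exists_isDriftConstant (N : Network RRH UH UR KR KH S) {ν : Measure (S × (UH ⊕ UR → ℝ))}
    (hν : ∀ᵐ x ∂ν, ∀ u, 0 ≤ x.2 u ∧ x.2 u ≤ N.Amax u) :
    ∃ C : ℝ, IsDriftConstant N ν C := by
  obtain ⟨M, hM0, hM⟩ := exists_rate_le N
  refine ⟨1 / 2 * ((N.W * N.ηreq * powerMax N) ^ 2 + (∑ _u : UH ⊕ UR, M) ^ 2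
    + ∑ u, (2 * N.Amax u ^ 2 + M ^ 2 * N.τ ^ 2 + N.Amax u ^ 2)), ?_⟩
  intro Ω _ P _ π γ hγ t
  have hm : MeasurableSpace.comap (π.χ γ t) inferInstance ≤ ‹MeasurableSpace Ω› :=
    (measurable_χ hγ t).comap_le.trans (π.info.le t)
  have key := condExp_mono (m := MeasurableSpace.comap (π.χ γ t) inferInstance)
    (essBdd_driftTerm hν hγ t).integrable (integrable_const _) (g := fun _ =>
      1 / 2 * ((N.W * N.ηreq * powerMax N) ^ 2 + (∑ _u : UH ⊕ UR, M) ^ 2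
    + ∑ u, (2 * N.Amax u ^ 2 + M ^ 2 * N.τ ^ 2 + N.Amax u ^ 2))) (by
    filter_upwards [π.ae_regular hν, hγ.ae_regularAux] with ω h h'
    have hμ : ∀ u, π.μ t ω u ≤ M := fun u => hM _ _ (h t).2.1 u
    have h1 := h.psum_nonneg t
    have h2 := (h t).2.1.powerSum_le
    have h3 := h.μsum_nonneg t
    have h4 : π.μsum t ω ≤ ∑ _u : UH ⊕ UR, M := by
      rw [μsum_eq]
      exact Finset.sum_le_sum fun u _ => hμ u
    have h5 := W_mul_ηreq_nonneg N
    have h6 := N.τ_pos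
    unfold driftTerm
    gcongr with u hu u hu u hu
    · exact h2
    · exact (h.adm_mem t u).1
    · exact (h.adm_mem t u).2
    · exact h.μ_nonneg t u
    · exact hμ u
    · exact (h' t u).1
    · exact (h' t u).2)
  rw [condExp_const hm] at key
  exact key

/-- By the tower property; the conditional bound is needed only through this consequence. -/
lemma integral_driftTerm_le {C : ℝ} (hC : IsDriftConstant N ν C) [IsProbabilityMeasure P]
    {π : Policy N ν P} (hγ : π.IsAux γ) (t : ℕ) : ∫ ω, π.driftTerm γ t ω ∂P ≤ C := by
  have hm : MeasurableSpace.comap (π.χ γ t) inferInstance ≤ mΩ :=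
    (measurable_χ hγ t).comap_le.trans (π.info.le t)
  rw [← integral_condExp hm]
  calc _ ≤ ∫ _, C ∂P := integral_mono_ae integrable_condExp (integrable_const _)
        (hC Ω P π γ hγ t)
    _ = C := by simp

end Policy

/-! ### From strong stability to mean rate stability. -/

/-- A non-negative sequence with bounded increments and bounded averages grows sublinearly. -/
lemma tendsto_div_of_bounded_average {q : ℕ → ℝ} {A B : ℝ} (hq : ∀ t, 0 ≤ q t)
    (hA : ∀ t, q (t + 1) ≤ q t + A)
    (hB : ∀ᶠ T : ℕ in atTop, (∑ t ∈ Finset.range T, q t) / T ≤ B) :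
    Tendsto (fun T : ℕ => q T / T) atTop (𝓝 0) := by
  have hstep : ∀ t i, q (t + i) ≤ q t + i * A := by
    intro t i
    induction i with
    | zero => simp
    | succ i ih =>
      have := hA (t + i)
      rw [← add_assoc]
      push_cast
      linarith
  -- Upward steps are at most `A`, so a large value at `T + K` forces the `K` preceding values to be
  -- almost as large.
  have hback : ∀ T K : ℕ, K * q (T + K) ≤ ∑ t ∈ Finset.range (T + K), q t + K * (K * |A|) := by
    intro T K
    have h1 : ∀ i ∈ Finset.range K, q (T + K) - K * |A| ≤ q (T + i) := by
      intro i hi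
      have hi : i ≤ K := (Finset.mem_range.1 hi).le
      have h2 := hstep (T + i) (K - i)
      rw [add_assoc, Nat.add_sub_cancel' hi] at h2
      have h3 : ((K - i : ℕ) : ℝ) * A ≤ K * |A| :=
        (mul_le_mul_of_nonneg_left (le_abs_self A) (Nat.cast_nonneg _)).trans
          (mul_le_mul_of_nonneg_right (by exact_mod_cast Nat.sub_le K i) (abs_nonneg A))
      linarith
    have h4 := Finset.sum_le_sum h1
    rw [Finset.sum_const, Finset.card_range, nsmul_eq_mul] at h4
    rw [Finset.sum_range_add]
    have h5 : 0 ≤ ∑ t ∈ Finset.range T, q t := Finset.sum_nonneg fun t _ => hq t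
    linarith
  refine tendsto_order.2 ⟨fun a ha => Eventually.of_forall fun T =>
    ha.trans_le (div_nonneg (hq T) (Nat.cast_nonneg T)), fun a ha => ?_⟩
  -- The backward estimate gives q(T)/T ≤ B/K + K|A|/T, so a fixed window with B/K < a suffices for
  -- large T.
  obtain ⟨K, hK⟩ := exists_nat_gt (max (B / a) 0)
  have hK0 : (0 : ℝ) < K := (le_max_right _ _).trans_lt hK
  have hBK : B / K < a := by
    rw [div_lt_iff₀ hK0]
    have := (le_max_left _ _).trans_lt hK
    rwa [div_lt_iff₀ ha, mul_comm] at this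
  have hlim : Tendsto (fun T : ℕ => B / K + (K * |A|) / T) atTop (𝓝 (B / K + 0)) :=
    tendsto_const_nhds.add (tendsto_const_div_atTop_nhds_zero_nat _)
  rw [add_zero] at hlim
  filter_upwards [hlim.eventually_lt_const hBK, hB, eventually_ge_atTop K,
    eventually_gt_atTop 0] with T h1 h2 h3 h4
  have hT : (0 : ℝ) < T := by exact_mod_cast h4
  refine lt_of_le_of_lt ?_ h1
  have h5 := hback (T - K) K
  rw [Nat.sub_add_cancel h3] at h5
  rw [div_le_iff₀ hT] at h2
  rw [div_le_iff₀ hT, add_mul, div_mul_cancel₀ _ hT.ne', div_mul_eq_mul_div,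
    div_add' _ _ _ hK0.ne', le_div_iff₀ hK0]
  linarith

/-! ### Necessary inequalities for the throughputs of any competing policy. -/

section Achievable

variable {RRH UH UR KR KH S : Type*} [Fintype RRH] [Fintype UH] [Fintype UR] [Fintype KR]
  [Fintype KH] [MeasurableSpace S] {Ω : Type} [mΩ : MeasurableSpace Ω]

/-- The average throughputs `r` can be achieved by a stationary policy that stabilizes the traffic
queues and meets the energy efficiency requirement, expressed in dual form. -/
def DualAchievable (N : Network RRH UH UR KR KH S) (ν : Measure (S × (UH ⊕ UR → ℝ)))
    (r : UH ⊕ UR → ℝ) : Prop :=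
  ∀ c : (UH ⊕ UR → ℝ) × (UH ⊕ UR → ℝ) × ℝ, (∀ u, 0 ≤ c.1 u) → (∀ u, 0 ≤ c.2.1 u) →
    0 ≤ c.2.2 → ∫ y, minSlotCost N c y ∂ν ≤ -∑ u, c.2.1 u * r u

namespace Policy

variable {N : Network RRH UH UR KR KH S} {ν : Measure (S × (UH ⊕ UR → ℝ))}
  {P : Measure Ω} [IsProbabilityMeasure P] {γ : ℕ → Ω → UH ⊕ UR → ℝ}
  [Finite S] [MeasurableSingletonClass S]
  (hν : ∀ᵐ x ∂ν, ∀ u, 0 ≤ x.2 u ∧ x.2 u ≤ N.Amax u)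
include hν

/-- The weights are deterministic, so only the law of the current state matters: the pointwise
minimum bounds the cost of any decision, whatever history it used. -/
lemma integral_minSlotCost_le (π : Policy N ν P) (c : (UH ⊕ UR → ℝ) × (UH ⊕ UR → ℝ) × ℝ)
    (t : ℕ) :
    ∫ y, minSlotCost N c y ∂ν
      ≤ ∑ u, (c.1 u - c.2.1 u) * ∫ ω, π.adm t ω u ∂P
        + (c.2.2 * (N.W * N.ηreq * ∫ ω, π.psum t ω ∂P)
          - ∑ u, (c.1 u * N.τ + c.2.2) * ∫ ω, π.μ t ω u ∂P) := by
  have hm : Measurable fun y : S × (UH ⊕ UR → ℝ) => minSlotCost N c y :=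
    (measurable_minSlotCost N).comp (f := fun y => (c, y)) (by fun_prop)
  have h1 : ∀ u, EssBdd P fun ω => (c.1 u - c.2.1 u) * π.adm t ω u := fun u =>
    (π.essBdd_adm hν t u).const_mul _
  have h2 : EssBdd P fun ω => c.2.2 * (N.W * N.ηreq * π.psum t ω) :=
    ((π.essBdd_psum hν t).const_mul _).const_mul _
  have h3 : ∀ u, EssBdd P fun ω => (c.1 u * N.τ + c.2.2) * π.μ t ω u := fun u =>
    (π.essBdd_μ hν t u).const_mul _
  obtain ⟨B, hB⟩ := exists_abs_minSlotCost_le N c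
  calc ∫ y, minSlotCost N c y ∂ν = ∫ ω, minSlotCost N c (π.state t ω) ∂P := by
        conv_lhs => rw [← π.state_law t]
        rw [integral_map (π.measurable_state t).aemeasurable hm.aestronglyMeasurable]
    _ ≤ ∫ ω, (∑ u, (c.1 u - c.2.1 u) * π.adm t ω u + (c.2.2 * (N.W * N.ηreq * π.psum t ω)
          - ∑ u, (c.1 u * N.τ + c.2.2) * π.μ t ω u)) ∂P := by
        refine integral_mono_ae ?_ (((EssBdd.sum h1).add (h2.sub (.sum h3))).integrable) ?_
        · exact EssBdd.integrable ⟨hm.comp (π.measurable_state t), B,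
            (π.ae_regular hν).mono fun ω h => hB _ (h t).2.2⟩
        · filter_upwards [π.ae_regular hν] with ω h
          exact minSlotCost_le N c (π.state t ω) (h t).1 (h t).2.1
    _ = _ := by
        rw [integral_add (EssBdd.sum h1).integrable (h2.sub (.sum h3)).integrable,
          integral_sub h2.integrable (EssBdd.sum h3).integrable,
          integral_finsetSum _ fun u _ => (h1 u).integrable,
          integral_finsetSum _ fun u _ => (h3 u).integrable]
        simp only [integral_const_mul]

lemma sum_adm_sub_sum_μ_le (π : Policy N ν P) (u : UH ⊕ UR) (T : ℕ) :
    ∑ t ∈ Finset.range T, ∫ ω, π.adm t ω u ∂P - N.τ * ∑ t ∈ Finset.range T, ∫ ω, π.μ t ω u ∂P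
      ≤ ∫ ω, π.Q T ω u ∂P := by
  induction T with
  | zero => simp [Q]
  | succ T ih =>
    have hQ := π.essBdd_Q hν T u
    have hμ := (π.essBdd_μ hν T u).mul_const N.τ
    have hR := π.essBdd_adm hν T u
    have h : ∫ ω, (π.Q T ω u - π.μ T ω u * N.τ + π.adm T ω u) ∂P ≤ ∫ ω, π.Q (T + 1) ω u ∂P :=
      integral_mono ((hQ.sub hμ).add hR).integrable (π.essBdd_Q hν (T + 1) u).integrable
        fun ω => add_le_add_left (le_max_left _ _) _
    rw [integral_add (hQ.sub hμ).integrable hR.integrable,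
      integral_sub hQ.integrable hμ.integrable, integral_mul_const] at h
    rw [Finset.sum_range_succ, Finset.sum_range_succ]
    linarith

lemma StronglyStable.tendsto_Q_div {π : Policy N ν P} (h : π.StronglyStable) (u : UH ⊕ UR) :
    Tendsto (fun T : ℕ => (∫ ω, π.Q T ω u ∂P) / T) atTop (𝓝 0) := by
  obtain ⟨B, hB⟩ := EReal.lt_iff_exists_real_btwn.1 (h u)
  refine tendsto_div_of_bounded_average (A := N.Amax u) (B := B) (fun t => ?_) (fun t => ?_) ?_
  · exact integral_nonneg_of_ae ((π.ae_regular hν).mono fun ω h => (h.Q_mem t u).1)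
  · calc ∫ ω, π.Q (t + 1) ω u ∂P ≤ ∫ ω, (π.Q t ω u + N.Amax u) ∂P := by
          refine integral_mono_ae (π.essBdd_Q hν (t + 1) u).integrable
            ((π.essBdd_Q hν t u).add (.const _)).integrable ?_
          filter_upwards [π.ae_regular hν] with ω h
          refine add_le_add (max_le ?_ (h.Q_mem t u).1) (h.adm_mem t u).2
          have := mul_nonneg (h.μ_nonneg t u) N.τ_pos.le
          linarith
      _ = _ := by
          rw [integral_add (π.essBdd_Q hν t u).integrable (integrable_const _)]
          simp
  · filter_upwards [eventually_lt_of_limsup_lt hB.1] with T hT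
    exact (EReal.coe_lt_coe_iff.1 hT).le

/-- Multiplying by the positive denominator turns the ratio constraint, valid up to ε for large T,
into a linear one; the maximal power makes the error uniform in T. -/
lemma MeetsEE.eventually_le {π : Policy N ν P} (h : π.MeetsEE) {ε : ℝ} (hε : 0 < ε) :
    ∀ᶠ T : ℕ in atTop,
      N.W * N.ηreq * ((∑ t ∈ Finset.range T, ∫ ω, π.psum t ω ∂P) / T)
        - (∑ t ∈ Finset.range T, ∫ ω, π.μsum t ω ∂P) / T ≤ ε * (N.W * powerMax N) := by
  have h1 : ((N.ηreq - ε : ℝ) : EReal) < liminf (fun T : ℕ => (π.EE T : EReal)) atTop :=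
    lt_of_lt_of_le (EReal.coe_lt_coe_iff.2 (by linarith)) h
  filter_upwards [eventually_lt_of_lt_liminf h1, eventually_gt_atTop 0] with T hT hT0
  have hT' : (0 : ℝ) < T := by exact_mod_cast hT0
  have hp : ∀ t, N.pcR + N.pcH ≤ ∫ ω, π.psum t ω ∂P ∧ ∫ ω, π.psum t ω ∂P ≤ powerMax N := by
    intro t
    constructor
    · calc N.pcR + N.pcH = ∫ _, (N.pcR + N.pcH) ∂P := by simp
        _ ≤ _ := integral_mono_ae (integrable_const _) (π.essBdd_psum hν t).integrable
            ((π.ae_regular hν).mono fun ω h => (h t).2.1.static_le_powerSum)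
    · calc _ ≤ ∫ _, powerMax N ∂P := integral_mono_ae (π.essBdd_psum hν t).integrable
            (integrable_const _) ((π.ae_regular hν).mono fun ω h => (h t).2.1.powerSum_le)
        _ = _ := by simp
  have hlow : N.pcR + N.pcH ≤ (∑ t ∈ Finset.range T, ∫ ω, π.psum t ω ∂P) / T := by
    rw [le_div_iff₀ hT', mul_comm, ← nsmul_eq_mul]
    simpa using Finset.card_nsmul_le_sum (Finset.range T) _ _ fun t _ => (hp t).1
  have hupp : (∑ t ∈ Finset.range T, ∫ ω, π.psum t ω ∂P) / T ≤ powerMax N := by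
    rw [div_le_iff₀ hT', mul_comm, ← nsmul_eq_mul]
    simpa using Finset.sum_le_card_nsmul (Finset.range T) _ _ fun t _ => (hp t).2
  have hT := EReal.coe_lt_coe_iff.1 hT
  unfold EE at hT
  set p := (∑ t ∈ Finset.range T, ∫ ω, π.psum t ω ∂P) / T
  have hWp : 0 < N.W * p := mul_pos N.W_pos (N.pc_pos.trans_le hlow)
  rw [lt_div_iff₀ hWp] at hT
  have : ε * (N.W * p) ≤ ε * (N.W * powerMax N) := by
    gcongr
    exact N.W_pos.le
  linarith

/-- Any limit of the average throughputs of a policy that stabilizes the traffic queues and meets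
the energy efficiency requirement is achievable. -/
theorem dualAchievable_of_tendsto {π : Policy N ν P} (hQ : π.StronglyStable) (hE : π.MeetsEE)
    {l : Filter ℕ} [l.NeBot] (hl : l ≤ atTop) {r : UH ⊕ UR → ℝ}
    (hr : Tendsto π.avgAdm l (𝓝 r)) : DualAchievable N ν r := by
  intro c hq hh hz
  -- The efficiency constraint costs an error ε for each large T, so T tends to infinity along `l`
  -- before ε tends to 0.
  have key : ∀ ε : ℝ, 0 < ε →
      ∫ y, minSlotCost N c y ∂ν ≤ c.2.2 * (ε * (N.W * powerMax N)) - ∑ u, c.2.1 u * r u := by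
    intro ε hε
    have hlim : Tendsto (fun T : ℕ => ∑ u, c.1 u * ((∫ ω, π.Q T ω u ∂P) / T)
        + c.2.2 * (ε * (N.W * powerMax N)) - ∑ u, c.2.1 u * π.avgAdm T u) l
        (𝓝 (∑ u, c.1 u * 0 + c.2.2 * (ε * (N.W * powerMax N)) - ∑ u, c.2.1 u * r u)) := by
      refine ((tendsto_finsetSum _ fun u _ => ?_).add tendsto_const_nhds).sub
        (tendsto_finsetSum _ fun u _ => ?_)
      · exact ((hQ.tendsto_Q_div hν u).mono_left hl).const_mul _
      · exact ((tendsto_pi_nhds.1 hr) u).const_mul _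
    simp only [mul_zero, Finset.sum_const_zero, zero_add] at hlim
    refine ge_of_tendsto hlim ?_
    filter_upwards [hl (hE.eventually_le hν hε), hl (eventually_gt_atTop 0)] with T hT hT0
    have hT' : (0 : ℝ) < T := by exact_mod_cast hT0
    have h1 := Finset.sum_le_sum fun t (_ : t ∈ Finset.range T) =>
      π.integral_minSlotCost_le hν c t
    simp only [Finset.sum_const, Finset.card_range, nsmul_eq_mul, Finset.sum_add_distrib,
      Finset.sum_sub_distrib] at h1
    rw [Finset.sum_comm, ← Finset.mul_sum, ← Finset.mul_sum,
      Finset.sum_comm (s := Finset.range T)] at h1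
    simp only [← Finset.mul_sum] at h1
    -- Admissions minus service is at most the terminal queue, which vanishes after division by T.
    have h2 : ∑ u, c.1 u * (∑ t ∈ Finset.range T, ∫ ω, π.adm t ω u ∂P
        - N.τ * ∑ t ∈ Finset.range T, ∫ ω, π.μ t ω u ∂P) ≤ ∑ u, c.1 u * ∫ ω, π.Q T ω u ∂P :=
      Finset.sum_le_sum fun u _ =>
        mul_le_mul_of_nonneg_left (π.sum_adm_sub_sum_μ_le hν u T) (hq u)
    have h3 : ∑ t ∈ Finset.range T, ∫ ω, π.μsum t ω ∂P
        = ∑ u, ∑ t ∈ Finset.range T, ∫ ω, π.μ t ω u ∂P := by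
      rw [Finset.sum_comm]
      refine Finset.sum_congr rfl fun t _ => ?_
      simp only [μsum_eq]
      exact integral_finsetSum _ fun u _ => (π.essBdd_μ hν t u).integrable
    have h4 := mul_le_mul_of_nonneg_left hT hz
    rw [h3] at h4
    have h5 : ∀ x : UH ⊕ UR → ℝ, ∑ u, c.1 u * (x u / T) = (∑ u, c.1 u * x u) / T := fun x => by
      rw [Finset.sum_div]
      exact Finset.sum_congr rfl fun u _ => by ring
    have h6 : ∑ u, c.2.1 u * π.avgAdm T u
        = (∑ u, c.2.1 u * ∑ t ∈ Finset.range T, ∫ ω, π.adm t ω u ∂P) / T := by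
      rw [Finset.sum_div]
      exact Finset.sum_congr rfl fun u _ => by unfold avgAdm; ring
    rw [h5, h6]
    simp only [sub_mul, add_mul, mul_sub, Finset.sum_sub_distrib, Finset.sum_add_distrib] at h1 h2
    simp only [← Finset.mul_sum] at h1
    simp only [mul_assoc] at h1 h2 h4 ⊢
    refine le_of_mul_le_mul_left ?_ hT'
    have h7 := mul_le_mul_of_nonneg_left h4 hT'.le
    rw [mul_sub, mul_add, mul_div_cancel₀ _ hT'.ne', mul_div_cancel₀ _ hT'.ne']
    have h8 : ∀ a b k w e : ℝ, T * (k * (w * (e * (a / T))) - k * (b / T))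
        = k * (w * (e * a)) - k * b := fun a b k w e => by field_simp
    rw [mul_sub (c.2.2), h8] at h7
    linarith
  have hlim : Tendsto (fun ε : ℝ => c.2.2 * (ε * (N.W * powerMax N)) - ∑ u, c.2.1 u * r u)
      (𝓝[>] 0) (𝓝 (c.2.2 * (0 * (N.W * powerMax N)) - ∑ u, c.2.1 u * r u)) :=
    Tendsto.mono_left (Continuous.tendsto (by fun_prop) 0) nhdsWithin_le_nhds
  rw [zero_mul, mul_zero, zero_sub] at hlim
  exact ge_of_tendsto hlim (eventually_mem_nhdsWithin.mono fun ε hε => key ε hε)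

end Policy

end Achievable

/-! ### Lyapunov drift of the algorithm. -/

lemma queue_sq_le {q a b : ℝ} (hq : 0 ≤ q) (ha : 0 ≤ a) (hb : 0 ≤ b) :
    (max (q - b) 0 + a) ^ 2 ≤ q ^ 2 + a ^ 2 + b ^ 2 + 2 * q * (a - b) := by
  rcases le_total (q - b) 0 with h | h
  · rw [max_eq_right h]
    nlinarith [mul_nonneg hq ha, sq_nonneg (q - b)]
  · rw [max_eq_left h]
    nlinarith [mul_nonneg ha hb]

namespace Policy

variable {RRH UH UR KR KH S : Type*} [Fintype RRH] [Fintype UH] [Fintype UR] [Fintype KR]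
  [Fintype KH] [MeasurableSpace S] {Ω : Type} [mΩ : MeasurableSpace Ω]
  {N : Network RRH UH UR KR KH S} {ν : Measure (S × (UH ⊕ UR → ℝ))}
  {P : Measure Ω} {γ : ℕ → Ω → UH ⊕ UR → ℝ}

/-- The quadratic Lyapunov function of all queues. -/
def lyapunov (π : Policy N ν P) (γ : ℕ → Ω → UH ⊕ UR → ℝ) (t : ℕ) (ω : Ω) : ℝ :=
  (1 / 2) * (∑ u, (π.Q t ω u ^ 2 + π.H γ t ω u ^ 2) + π.Z t ω ^ 2)

/-- This is `queue_sq_le` applied to every queue. An admission is an arrival to Q and a service of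
H, whence the factor 2 on its square; splitting Z μ_sum over the users produces the weights Q τ + Z.
-/
lemma Regular.lyapunov_succ_le {π : Policy N ν P} {ω : Ω} (h : π.Regular ω)
    (hγ : RegularAux N γ ω) (t : ℕ) :
    π.lyapunov γ (t + 1) ω ≤ π.lyapunov γ t ω + π.driftTerm γ t ω
      + slotCost N (π.χ γ t ω) (π.state t ω).1 (π.adm t ω) (π.dec t ω)
      + ∑ u, π.H γ t ω u * γ t ω u := by
  have hQ : ∀ u, π.Q (t + 1) ω u ^ 2 ≤ π.Q t ω u ^ 2 + π.adm t ω u ^ 2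
      + (π.μ t ω u * N.τ) ^ 2 + 2 * π.Q t ω u * (π.adm t ω u - π.μ t ω u * N.τ) := fun u =>
    queue_sq_le (h.Q_mem t u).1 (h.adm_mem t u).1 (mul_nonneg (h.μ_nonneg t u) N.τ_pos.le)
  have hH : ∀ u, π.H γ (t + 1) ω u ^ 2 ≤ π.H γ t ω u ^ 2 + γ t ω u ^ 2
      + π.adm t ω u ^ 2 + 2 * π.H γ t ω u * (γ t ω u - π.adm t ω u) := fun u =>
    queue_sq_le (h.H_mem hγ t u).1 (hγ t u).1 (h.adm_mem t u).1
  have hZ : π.Z (t + 1) ω ^ 2 ≤ π.Z t ω ^ 2 + (N.W * N.ηreq * π.psum t ω) ^ 2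
      + π.μsum t ω ^ 2 + 2 * π.Z t ω * (N.W * N.ηreq * π.psum t ω - π.μsum t ω) :=
    queue_sq_le (h.Z_mem t).1 (mul_nonneg (W_mul_ηreq_nonneg N) (h.psum_nonneg t))
      (h.μsum_nonneg t)
  have hsum := Finset.sum_le_sum fun u (_ : u ∈ Finset.univ) => add_le_add (hQ u) (hH u)
  have hμ : π.Z t ω * π.μsum t ω = ∑ u, π.Z t ω * π.μ t ω u := by
    rw [μsum_eq, Finset.mul_sum]
  have hrate : ∀ u, rate N (π.state t ω).1 (π.dec t ω) u = π.μ t ω u := fun u => rfl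
  have hp : powerSum N (π.dec t ω) = π.psum t ω := rfl
  have hsplit : ∑ u, (π.Q t ω u ^ 2 + π.adm t ω u ^ 2
        + (π.μ t ω u * N.τ) ^ 2 + 2 * π.Q t ω u * (π.adm t ω u - π.μ t ω u * N.τ)
      + (π.H γ t ω u ^ 2 + γ t ω u ^ 2
        + π.adm t ω u ^ 2 + 2 * π.H γ t ω u * (γ t ω u - π.adm t ω u)))
      = ∑ u, (π.Q t ω u ^ 2 + π.H γ t ω u ^ 2)
        + ∑ u, (2 * π.adm t ω u ^ 2 + π.μ t ω u ^ 2 * N.τ ^ 2 + γ t ω u ^ 2)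
        + 2 * (∑ u, (π.Q t ω u - π.H γ t ω u) * π.adm t ω u
          + (∑ u, π.Z t ω * π.μ t ω u - ∑ u, (π.Q t ω u * N.τ + π.Z t ω) * π.μ t ω u)
          + ∑ u, π.H γ t ω u * γ t ω u) := by
    simp only [← Finset.sum_add_distrib, ← Finset.sum_sub_distrib, Finset.mul_sum]
    exact Finset.sum_congr rfl fun u _ => by ring
  rw [hsplit, ← hμ] at hsum
  simp only [lyapunov, driftTerm, slotCost, allocCost, χ, hrate, hp]
  linarith

variable [IsProbabilityMeasure P] [Finite S] [MeasurableSingletonClass S]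

lemma indepFun_χ_state {π : Policy N ν P} (hγ : π.IsAux γ) (t : ℕ) :
    IndepFun (π.χ γ t) (π.state t) P :=
  (IndepFun_iff_Indep _ _ _).2
    (indep_of_indep_of_le_left (π.state_indep t) (measurable_χ hγ t).comap_le)

variable (hν : ∀ᵐ x ∂ν, ∀ u, 0 ≤ x.2 u ∧ x.2 u ≤ N.Amax u)
include hν

lemma essBdd_lyapunov {π : Policy N ν P} (hγ : π.IsAux γ) (t : ℕ) :
    EssBdd P (π.lyapunov γ t) :=
  .const_mul _ ((EssBdd.sum fun u => (π.essBdd_Q hν t u).sq.add (essBdd_H hν hγ t u).sq).add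
    (π.essBdd_Z hν t).sq)

lemma essBdd_slotCost {π : Policy N ν P} (hγ : π.IsAux γ) (t : ℕ) :
    EssBdd P fun ω =>
      slotCost N (π.χ γ t ω) (π.state t ω).1 (π.adm t ω) (π.dec t ω) :=
  (EssBdd.sum fun u =>
    ((π.essBdd_Q hν t u).sub (essBdd_H hν hγ t u)).mul (π.essBdd_adm hν t u)).add
  (((π.essBdd_Z hν t).mul ((π.essBdd_psum hν t).const_mul _)).sub
    (.sum fun u => (((π.essBdd_Q hν t u).mul_const _).add (π.essBdd_Z hν t)).mul
      (π.essBdd_μ hν t u)))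

/-- The algorithm attains the minimal cost at the random weights χ(t). By independence the joint law
with the state is a product, so Fubini freezes the weights and dual achievability applies to almost
every value of them. -/
lemma IsDriftPlusPenalty.integral_slotCost_le {V : ℝ} {π : Policy N ν P}
    (h : π.IsDriftPlusPenalty V γ) {r : UH ⊕ UR → ℝ} (hr : DualAchievable N ν r) (t : ℕ) :
    ∫ ω, slotCost N (π.χ γ t ω) (π.state t ω).1 (π.adm t ω) (π.dec t ω) ∂P
      ≤ -∑ u, (∫ ω, π.H γ t ω u ∂P) * r u := by
  have hχ : Measurable (π.χ γ t) := (measurable_χ h.aux t).mono (π.info.le t) le_rfl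
  have hs := π.measurable_state t
  have : SFinite ν := by
    rw [← π.state_law t]
    infer_instance
  have hlaw : P.map (fun ω => (π.χ γ t ω, π.state t ω)) = (P.map (π.χ γ t)).prod ν := by
    rw [(indepFun_iff_map_prod_eq_prod_map_map hχ.aemeasurable hs.aemeasurable).1
      (indepFun_χ_state h.aux t), π.state_law t]
  have heq : (fun ω => slotCost N (π.χ γ t ω) (π.state t ω).1 (π.adm t ω) (π.dec t ω))
      =ᵐ[P] fun ω => minSlotCost N (π.χ γ t ω) (π.state t ω) := by
    filter_upwards [π.ae_regular hν, h.adm_opt t, h.dec_opt t] with ω h1 h2 h3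
    exact (minSlotCost_eq N (π.χ γ t ω) (π.state t ω) h2 (h1 t).2.1 h3).symm
  have hm := measurable_minSlotCost N
  have hint : Integrable (fun p => minSlotCost N p.1 p.2) ((P.map (π.χ γ t)).prod ν) := by
    rw [← hlaw, integrable_map_measure hm.aestronglyMeasurable (hχ.prodMk hs).aemeasurable]
    exact (essBdd_slotCost hν h.aux t).integrable.congr heq
  have hH : ∀ u, EssBdd P fun ω => π.H γ t ω u * r u := fun u =>
    (essBdd_H hν h.aux t u).mul_const _
  have hlin : Measurable fun c : (UH ⊕ UR → ℝ) × (UH ⊕ UR → ℝ) × ℝ => -∑ u, c.2.1 u * r u := by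
    fun_prop
  rw [integral_congr_ae heq]
  calc ∫ ω, minSlotCost N (π.χ γ t ω) (π.state t ω) ∂P
      = ∫ p, minSlotCost N p.1 p.2 ∂((P.map (π.χ γ t)).prod ν) := by
        rw [← hlaw, integral_map (hχ.prodMk hs).aemeasurable hm.aestronglyMeasurable]
    _ = ∫ c, ∫ y, minSlotCost N c y ∂ν ∂(P.map (π.χ γ t)) := integral_prod _ hint
    _ ≤ ∫ c, -∑ u, c.2.1 u * r u ∂(P.map (π.χ γ t)) := by
        refine integral_mono_ae hint.integral_prod_left ?_ ?_
        · rw [integrable_map_measure hlin.aestronglyMeasurable hχ.aemeasurable]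
          exact (EssBdd.sum hH).integrable.neg
        · have hmeas : MeasurableSet {c : (UH ⊕ UR → ℝ) × (UH ⊕ UR → ℝ) × ℝ |
              (∀ u, 0 ≤ c.1 u) ∧ (∀ u, 0 ≤ c.2.1 u) ∧ 0 ≤ c.2.2} := by
            measurability
          have hpos : ∀ᵐ c ∂(P.map (π.χ γ t)),
              (∀ u, 0 ≤ c.1 u) ∧ (∀ u, 0 ≤ c.2.1 u) ∧ 0 ≤ c.2.2 := by
            rw [ae_map_iff hχ.aemeasurable hmeas]
            filter_upwards [π.ae_regular hν, h.aux.ae_regularAux] with ω h1 h2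
            exact ⟨fun u => (h1.Q_mem t u).1, fun u => (h1.H_mem h2 t u).1, (h1.Z_mem t).1⟩
          exact hpos.mono fun c hc => hr c hc.1 hc.2.1 hc.2.2
    _ = -∑ u, (∫ ω, π.H γ t ω u ∂P) * r u := by
        rw [integral_map hχ.aemeasurable hlin.aestronglyMeasurable]
        simp only [χ]
        rw [integral_neg, integral_finsetSum _ fun u _ => (hH u).integrable]
        simp only [integral_mul_const]

/-- The telescoped drift-plus-penalty inequality. -/
theorem IsDriftPlusPenalty.integral_lyapunov_le {C V : ℝ} (hC : IsDriftConstant N ν C)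
    {π : Policy N ν P} (h : π.IsDriftPlusPenalty V γ) {r : UH ⊕ UR → ℝ}
    (hr : DualAchievable N ν r) {φ : UH ⊕ UR → ℝ → ℝ}
    (hφ : ∀ t u, EssBdd P fun ω => φ u (γ t ω u))
    (hopt : ∀ t, ∀ᵐ ω ∂P, ∀ u, V * φ u (r u) - π.H γ t ω u * r u
      ≤ V * φ u (γ t ω u) - π.H γ t ω u * γ t ω u) (T : ℕ) :
    ∫ ω, π.lyapunov γ T ω ∂P ≤ T * (C - V * ∑ u, φ u (r u))
      + V * ∑ u, ∑ t ∈ Finset.range T, ∫ ω, φ u (γ t ω u) ∂P := by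
  induction T with
  | zero => simp [lyapunov, Q, H, Z]
  | succ t ih =>
    have hL := essBdd_lyapunov hν h.aux t
    have hD := essBdd_driftTerm hν h.aux t
    have hc := essBdd_slotCost hν h.aux t
    have hH : ∀ u, EssBdd P fun ω => π.H γ t ω u * r u := fun u =>
      (essBdd_H hν h.aux t u).mul_const _
    have hV : ∀ u, EssBdd P fun ω => V * (φ u (γ t ω u) - φ u (r u)) := fun u =>
      ((hφ t u).sub (.const _)).const_mul _
    have h1 : ∫ ω, π.lyapunov γ (t + 1) ω ∂P ≤ ∫ ω, (π.lyapunov γ t ω + π.driftTerm γ t ω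
        + slotCost N (π.χ γ t ω) (π.state t ω).1 (π.adm t ω) (π.dec t ω)
        -- Optimality of γ replaces H γ by H r plus a utility difference; in expectation H r cancels
        -- against the bound on `slotCost`.
        + (∑ u, π.H γ t ω u * r u + ∑ u, V * (φ u (γ t ω u) - φ u (r u)))) ∂P := by
      refine integral_mono_ae (essBdd_lyapunov hν h.aux (t + 1)).integrable
        (((hL.add hD).add hc).add ((EssBdd.sum hH).add (.sum hV))).integrable ?_
      filter_upwards [π.ae_regular hν, h.aux.ae_regularAux, hopt t] with ω h2 h3 h4
      refine (h2.lyapunov_succ_le h3 t).trans ?_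
      rw [← Finset.sum_add_distrib]
      refine add_le_add le_rfl (Finset.sum_le_sum fun u _ => ?_)
      have := h4 u
      linarith
    rw [integral_add ((hL.add hD).add hc).integrable ((EssBdd.sum hH).add (.sum hV)).integrable,
      integral_add (hL.add hD).integrable hc.integrable,
      integral_add hL.integrable hD.integrable,
      integral_add (EssBdd.sum hH).integrable (EssBdd.sum hV).integrable,
      integral_finsetSum _ fun u _ => (hH u).integrable,
      integral_finsetSum _ fun u _ => (hV u).integrable] at h1
    have h2 : ∀ u, ∫ ω, V * (φ u (γ t ω u) - φ u (r u)) ∂P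
        = V * ∫ ω, φ u (γ t ω u) ∂P - V * φ u (r u) := fun u => by
      rw [integral_const_mul, integral_sub (hφ t u).integrable (integrable_const _)]
      simp [mul_sub]
    simp only [integral_mul_const, h2, Finset.sum_sub_distrib] at h1
    have h3 := integral_driftTerm_le hC h.aux t
    have h4 := h.integral_slotCost_le hν hr t
    simp only [Finset.sum_range_succ, Finset.sum_add_distrib, mul_add]
    simp only [← Finset.mul_sum] at h1
    push_cast
    linarith

lemma avg_aux_le (π : Policy N ν P) (hγ : π.IsAux γ) (u : UH ⊕ UR) (T : ℕ) :
    ∑ t ∈ Finset.range T, ∫ ω, γ t ω u ∂P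
      ≤ ∑ t ∈ Finset.range T, ∫ ω, π.adm t ω u ∂P + ∫ ω, π.H γ T ω u ∂P := by
  induction T with
  | zero => simp [H]
  | succ T ih =>
    have hH := essBdd_H hν hγ T u
    have hg := essBdd_aux hγ T u
    have hR := π.essBdd_adm hν T u
    have h : ∫ ω, (π.H γ T ω u - π.adm T ω u + γ T ω u) ∂P ≤ ∫ ω, π.H γ (T + 1) ω u ∂P :=
      integral_mono ((hH.sub hR).add hg).integrable (essBdd_H hν hγ (T + 1) u).integrable
        fun ω => add_le_add_left (le_max_left _ _) _
    rw [integral_add (hH.sub hR).integrable hg.integrable,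
      integral_sub hH.integrable hR.integrable] at h
    rw [Finset.sum_range_succ, Finset.sum_range_succ]
    linarith

/-- A linearly growing Lyapunov function makes the virtual queues mean rate stable. -/
lemma tendsto_H_div {π : Policy N ν P} (hγ : π.IsAux γ) {K : ℝ}
    (hK : ∀ T : ℕ, ∫ ω, π.lyapunov γ T ω ∂P ≤ T * K) (u : UH ⊕ UR) :
    Tendsto (fun T : ℕ => (∫ ω, π.H γ T ω u ∂P) / T) atTop (𝓝 0) := by
  refine tendsto_order.2 ⟨fun a ha => Eventually.of_forall fun T => ha.trans_le
    (div_nonneg (integral_nonneg_of_ae ?_) (Nat.cast_nonneg T)), fun a ha => ?_⟩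
  · filter_upwards [π.ae_regular hν, hγ.ae_regularAux] with ω h h'
    exact (h.H_mem h' T u).1
  have hlim : Tendsto (fun T : ℕ => a / 2 + (K / a) / T) atTop (𝓝 (a / 2 + 0)) :=
    tendsto_const_nhds.add (tendsto_const_div_atTop_nhds_zero_nat _)
  filter_upwards [hlim.eventually_lt_const (show a / 2 + 0 < a by linarith),
    eventually_gt_atTop 0] with T h1 h2
  have hT : (0 : ℝ) < T := by exact_mod_cast h2
  refine lt_of_le_of_lt ?_ h1
  have hL := essBdd_lyapunov hν hγ T
  -- The inequality H ≤ aT/2 + H²/(2aT) bounds E H linearly by E L without square roots; after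
  -- division by T the bound is a/2 + (K/a)/T.
  have h3 : ∫ ω, π.H γ T ω u ∂P
      ≤ ∫ ω, (a * T / 2 + 1 / (a * T) * π.lyapunov γ T ω) ∂P := by
    refine integral_mono (essBdd_H hν hγ T u).integrable
      ((EssBdd.const _).add (hL.const_mul _)).integrable fun ω => ?_
    have h4 : π.H γ T ω u ^ 2 ≤ 2 * π.lyapunov γ T ω := by
      have h5 : π.H γ T ω u ^ 2 ≤ ∑ u, (π.Q T ω u ^ 2 + π.H γ T ω u ^ 2) :=
        (le_add_of_nonneg_left (sq_nonneg _)).trans (Finset.single_le_sum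
          (f := fun u => π.Q T ω u ^ 2 + π.H γ T ω u ^ 2) (fun u _ => by positivity)
          (Finset.mem_univ u))
      have h6 := sq_nonneg (π.Z T ω)
      unfold lyapunov
      linarith
    have h7 : 0 < a * T := mul_pos ha hT
    have h8 : 1 / (a * T) * (π.H γ T ω u ^ 2 / 2) ≤ 1 / (a * T) * π.lyapunov γ T ω := by
      gcongr
      linarith
    refine le_trans ?_ (add_le_add le_rfl h8)
    have h9 : a * T / 2 + 1 / (a * T) * (π.H γ T ω u ^ 2 / 2) - π.H γ T ω u
        = (a * T - π.H γ T ω u) ^ 2 / (2 * (a * T)) := by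
      field_simp
      ring
    have h10 : 0 ≤ (a * T - π.H γ T ω u) ^ 2 / (2 * (a * T)) := by positivity
    linarith
  rw [integral_add (integrable_const _) (hL.const_mul _).integrable, integral_const_mul] at h3
  simp only [integral_const, probReal_univ, one_smul] at h3
  rw [div_le_iff₀ hT]
  refine h3.trans ?_
  have h11 : 1 / (a * T) * ∫ ω, π.lyapunov γ T ω ∂P ≤ 1 / (a * T) * (T * K) := by
    gcongr
    exact hK T
  refine (add_le_add le_rfl h11).trans (le_of_eq ?_)
  field_simp

end Policy

/-! ### Finite sums and scaling in the extended reals. -/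

section ERealSums

variable {ι κ : Type*} (s : Finset ι)

lemma ereal_sum_ne_top {f : ι → EReal} (h : ∀ i, f i ≠ ⊤) : ∑ i ∈ s, f i ≠ ⊤ := by
  classical
  induction s using Finset.induction_on with
  | empty => simp
  | insert i s hi ih =>
    rw [Finset.sum_insert hi]
    exact EReal.add_ne_top (h i) ih

lemma ereal_coe_sum (f : ι → ℝ) : ((∑ i ∈ s, f i : ℝ) : EReal) = ∑ i ∈ s, (f i : EReal) := by
  classical
  induction s using Finset.induction_on with
  | empty => simp
  | insert i s hi ih =>
    rw [Finset.sum_insert hi, Finset.sum_insert hi, EReal.coe_add, ih]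

lemma ereal_mul_sum {c : ℝ} (hc : 0 ≤ c) (f : ι → EReal) :
    (c : EReal) * ∑ i ∈ s, f i = ∑ i ∈ s, (c : EReal) * f i := by
  classical
  induction s using Finset.induction_on with
  | empty => simp
  | insert i s hi ih =>
    rw [Finset.sum_insert hi, Finset.sum_insert hi, EReal.left_distrib_of_nonneg_of_ne_top
      (EReal.coe_nonneg.2 hc) (EReal.coe_ne_top c), ih]

lemma ne_bot_of_ereal_sum_ne_bot {s : Finset ι} {f : ι → EReal} (h : ∑ i ∈ s, f i ≠ ⊥) {i : ι}
    (hi : i ∈ s) : f i ≠ ⊥ := by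
  classical
  rw [← Finset.add_sum_erase s f hi] at h
  exact (EReal.add_ne_bot_iff.1 h).1

/-- Addition on `EReal` is discontinuous only where opposite infinities meet, which finite-or-`⊥`
limits exclude. -/
lemma ereal_tendsto_sum {l : Filter κ} {f : ι → κ → EReal} {a : ι → EReal}
    (h : ∀ i, Tendsto (f i) l (𝓝 (a i))) (ha : ∀ i, a i ≠ ⊤) :
    Tendsto (fun x => ∑ i ∈ s, f i x) l (𝓝 (∑ i ∈ s, a i)) := by
  classical
  induction s using Finset.induction_on with
  | empty => simpa using tendsto_const_nhds
  | insert i s hi ih =>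
    simp only [Finset.sum_insert hi]
    exact (EReal.continuousAt_add (p := (a i, ∑ i ∈ s, a i)) (.inl (ha i))
      (.inr (ereal_sum_ne_top s ha))).tendsto.comp ((h i).prodMk_nhds ih)

end ERealSums

lemma ereal_coe_mul_ne_top {c : ℝ} (hc : 0 < c) {x : EReal} (hx : x ≠ ⊤) :
    (c : EReal) * x ≠ ⊤ := by
  induction x with
  | bot => rw [EReal.coe_mul_bot_of_pos hc]; exact bot_ne_top
  | coe x => rw [← EReal.coe_mul]; exact EReal.coe_ne_top _
  | top => exact absurd rfl hx

lemma ereal_coe_mul_ne_bot {c : ℝ} (hc : 0 < c) {x : EReal} (hx : x ≠ ⊥) :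
    (c : EReal) * x ≠ ⊥ := by
  induction x with
  | bot => exact absurd rfl hx
  | coe x => rw [← EReal.coe_mul]; exact EReal.coe_ne_bot _
  | top => rw [EReal.coe_mul_top_of_pos hc]; exact top_ne_bot

/-! ### Concave utilities with a possible value -∞ at 0: supporting lines and Jensen. -/

namespace IsUtility

variable {g : ℝ → EReal}

lemma ne_top (hg : IsUtility g) {y : ℝ} (hy : 0 ≤ y) : g y ≠ ⊤ := fun h => by
  have h1 : g y ≤ g (y + 1) := hg.mono hy (mem_Ici.2 (by linarith)) (by linarith)
  rw [h] at h1
  exact (hg.finite (y + 1) (by linarith)).2 (top_le_iff.1 h1)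

lemma const_mul (hg : IsUtility g) {c : ℝ} (hc : 0 < c) :
    IsUtility fun y => (c : EReal) * g y where
  finite x hx := ⟨ereal_coe_mul_ne_bot hc (hg.finite x hx).1,
    ereal_coe_mul_ne_top hc (hg.finite x hx).2⟩
  mono x hx y hy hxy := mul_le_mul_of_nonneg_left (hg.mono hx hy hxy) (EReal.coe_nonneg.2 hc.le)
  concave := by
    simpa [EReal.toReal_mul] using hg.concave.smul hc.le
  cont := by
    have h : ContinuousAt (fun p : EReal × EReal => p.1 * p.2) ((c : EReal), g 0) :=
      EReal.continuousAt_mul (.inl (by simpa using hc.ne')) (.inl (by simpa using hc.ne'))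
        (.inl (EReal.coe_ne_bot c)) (.inl (EReal.coe_ne_top c))
    exact h.tendsto.comp (tendsto_const_nhds.prodMk_nhds hg.cont)

lemma coe_toReal (hg : IsUtility g) {y : ℝ} (hy : 0 ≤ y) (h : g y ≠ ⊥) :
    ((g y).toReal : EReal) = g y :=
  EReal.coe_toReal (hg.ne_top hy) h

lemma continuousOn (hg : IsUtility g) : ContinuousOn g (Ici 0) := by
  intro y hy
  rcases eq_or_lt_of_le (mem_Ici.1 hy) with rfl | hy
  · exact continuousWithinAt_Ioi_iff_Ici.1 hg.cont
  · have h1 : ContinuousAt (fun x => (g x).toReal) y :=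
      (hg.concave.continuousOn isOpen_Ioi).continuousAt (Ioi_mem_nhds hy)
    have h2 : ContinuousAt (fun x => ((g x).toReal : EReal)) y :=
      continuous_coe_real_ereal.continuousAt.comp h1
    refine (h2.congr ?_).continuousWithinAt
    filter_upwards [Ioi_mem_nhds hy] with x hx
    exact EReal.coe_toReal (hg.finite x hx).2 (hg.finite x hx).1

lemma toReal_mono (hg : IsUtility g) {x y : ℝ} (hx : 0 ≤ x) (hxy : x ≤ y) (h : g x ≠ ⊥) :
    (g x).toReal ≤ (g y).toReal :=
  EReal.toReal_le_toReal (hg.mono hx (hx.trans hxy) hxy) h (hg.ne_top (hx.trans hxy))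

/-- A supporting line, its slope obtained from the right derivative of -g at y₀, extended to the
endpoint 0 by continuity. At y₀ = 0 it may fail to exist, as for the square root. -/
lemma exists_affine_ge (hg : IsUtility g) {y₀ : ℝ} (hy₀ : 0 < y₀) :
    ∃ k : ℝ, ∀ y, 0 ≤ y → g y ≠ ⊥ → (g y).toReal ≤ (g y₀).toReal + k * (y - y₀) := by
  have hc : ConvexOn ℝ (Ioi 0) (-fun x => (g x).toReal) := hg.concave.neg
  have hint : ∀ {y : ℝ}, 0 < y → y ∈ interior (Ioi (0 : ℝ)) := fun hy => by
    rwa [interior_Ioi]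
  set k := derivWithin (-fun x => (g x).toReal) (Ioi y₀) y₀
  have hpos : ∀ y, 0 < y → (g y).toReal ≤ (g y₀).toReal + -k * (y - y₀) := by
    intro y hy
    rcases lt_trichotomy y y₀ with h | rfl | h
    · have h1 := (hc.slope_le_leftDeriv_of_mem_interior hy (hint hy₀) h).trans
        (hc.leftDeriv_le_rightDeriv_of_mem_interior (hint hy₀))
      rw [slope_def_field, div_le_iff₀ (by linarith)] at h1
      simp only [Pi.neg_apply] at h1
      change _ ≤ k * _ at h1
      linarith
    · simp
    · have h1 := hc.rightDeriv_le_slope_of_mem_interior (hint hy₀) hy h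
      rw [slope_def_field, le_div_iff₀ (by linarith)] at h1
      simp only [Pi.neg_apply] at h1
      change k * _ ≤ _ at h1
      linarith
  refine ⟨-k, fun y hy hb => ?_⟩
  rcases eq_or_lt_of_le hy with rfl | hy
  · have h1 : Tendsto (fun x => (g x).toReal) (𝓝[>] 0) (𝓝 (g 0).toReal) :=
      (EReal.tendsto_toReal (hg.ne_top le_rfl) hb).comp hg.cont
    have h2 : Tendsto (fun x => (g y₀).toReal + -k * (x - y₀)) (𝓝[>] 0)
        (𝓝 ((g y₀).toReal + -k * (0 - y₀))) :=
      Tendsto.mono_left (Continuous.tendsto (by fun_prop) 0) nhdsWithin_le_nhds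
    exact le_of_tendsto_of_tendsto h1 h2 (eventually_mem_nhdsWithin.mono hpos)
  · exact hpos y hy

end IsUtility

/-- The real part of a utility function, extended constantly to the negative half line. -/
def realPart (g : ℝ → EReal) (y : ℝ) : ℝ := (g (max y 0)).toReal

lemma realPart_of_nonneg (g : ℝ → EReal) {y : ℝ} (hy : 0 ≤ y) : realPart g y = (g y).toReal := by
  rw [realPart, max_eq_left hy]

lemma IsUtility.measurable_realPart {g : ℝ → EReal} (hg : IsUtility g) :
    Measurable (realPart g) := by
  have : Monotone fun y => g (max y 0) := fun x y hxy =>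
    hg.mono (mem_Ici.2 (le_max_right _ _)) (mem_Ici.2 (le_max_right _ _)) (max_le_max_right 0 hxy)
  exact this.measurable.ereal_toReal

/-- Jensen's inequality for the time average of a finite number of random variables. -/
lemma IsUtility.average_le {Ω : Type*} [MeasurableSpace Ω] {P : Measure Ω} [IsProbabilityMeasure P]
    {g : ℝ → EReal} (hg : IsUtility g) {X : ℕ → Ω → ℝ} (hX : ∀ t, EssBdd P (X t))
    (hX0 : ∀ t, ∀ᵐ ω ∂P, 0 ≤ X t ω) (hgX : ∀ t, EssBdd P fun ω => realPart g (X t ω))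
    (hbot : ∀ t, ∀ᵐ ω ∂P, g (X t ω) ≠ ⊥) {T : ℕ} (hT : 0 < T) :
    (((∑ t ∈ Finset.range T, ∫ ω, realPart g (X t ω) ∂P) / T : ℝ) : EReal)
      ≤ g ((∑ t ∈ Finset.range T, ∫ ω, X t ω ∂P) / T) := by
  have hT' : (0 : ℝ) < T := by exact_mod_cast hT
  have hpos : ∀ t, 0 ≤ ∫ ω, X t ω ∂P := fun t => integral_nonneg_of_ae (hX0 t)
  have hsum : 0 ≤ ∑ t ∈ Finset.range T, ∫ ω, X t ω ∂P := Finset.sum_nonneg fun t _ => hpos t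
  set y₀ := (∑ t ∈ Finset.range T, ∫ ω, X t ω ∂P) / T with hy₀def
  -- A zero average leaves no supporting line, but then every variable vanishes almost surely and
  -- equality holds.
  rcases eq_or_lt_of_le (div_nonneg hsum hT'.le) with h0 | h0
  · have hzero : ∀ t ∈ Finset.range T, ∫ ω, X t ω ∂P = 0 := by
      have h1 := (div_eq_zero_iff.1 h0.symm).resolve_right hT'.ne'
      exact (Finset.sum_eq_zero_iff_of_nonneg fun t _ => hpos t).1 h1
    have hae : ∀ t ∈ Finset.range T, X t =ᵐ[P] 0 := fun t ht =>
      (integral_eq_zero_iff_of_nonneg_ae (hX0 t) (hX t).integrable).1 (hzero t ht)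
    have hb : g 0 ≠ ⊥ := by
      obtain ⟨ω, h1, h2⟩ := ((hae 0 (Finset.mem_range.2 hT)).and (hbot 0)).exists
      rwa [h1] at h2
    have hint : ∀ t ∈ Finset.range T, ∫ ω, realPart g (X t ω) ∂P = (g 0).toReal := by
      intro t ht
      calc _ = ∫ _, (g 0).toReal ∂P := by
            refine integral_congr_ae ((hae t ht).mono fun ω h => ?_)
            simp only [h, Pi.zero_apply]
            exact realPart_of_nonneg g le_rfl
        _ = _ := by simp
    rw [hy₀def.trans h0.symm, Finset.sum_congr rfl hint]
    simp only [Finset.sum_const, Finset.card_range, nsmul_eq_mul]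
    rw [mul_div_cancel_left₀ _ hT'.ne', hg.coe_toReal le_rfl hb]
  · obtain ⟨k, hk⟩ := hg.exists_affine_ge h0
    change 0 < y₀ at h0
    have h1 : ∀ t, ∫ ω, realPart g (X t ω) ∂P
        ≤ (g y₀).toReal + k * (∫ ω, X t ω ∂P - y₀) := by
      intro t
      calc _ ≤ ∫ ω, ((g y₀).toReal + k * (X t ω - y₀)) ∂P := by
            refine integral_mono_ae (hgX t).integrable
              ((EssBdd.const _).add (((hX t).sub (.const _)).const_mul _)).integrable ?_
            filter_upwards [hX0 t, hbot t] with ω h2 h3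
            simp only [realPart_of_nonneg g h2]
            exact hk _ h2 h3
        _ = _ := by
            rw [integral_add (integrable_const _)
              (((hX t).sub (.const _)).const_mul _).integrable, integral_const_mul,
              integral_sub (hX t).integrable (integrable_const _)]
            simp
    have h2 := Finset.sum_le_sum fun t (_ : t ∈ Finset.range T) => h1 t
    rw [Finset.sum_add_distrib, ← Finset.mul_sum, Finset.sum_sub_distrib] at h2
    simp only [Finset.sum_const, Finset.card_range, nsmul_eq_mul] at h2
    have h3 : ∑ t ∈ Finset.range T, ∫ ω, X t ω ∂P = T * y₀ := by
      rw [hy₀def, mul_div_cancel₀ _ hT'.ne']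
    rw [h3, sub_self, mul_zero, add_zero] at h2
    rw [← hg.coe_toReal h0.le (hg.finite y₀ h0).1, EReal.coe_le_coe_iff, div_le_iff₀ hT']
    linarith

/-! ### The network utility as a continuous monotone function of the throughputs. -/

section Utility

variable {RRH UH UR KR KH S : Type*} (N : Network RRH UH UR KR KH S)

lemma isUtility_userUtility (u : UH ⊕ UR) : IsUtility (userUtility N u) := by
  rcases u with m | j
  · exact N.gH_utility.const_mul N.β_pos
  · exact N.gR_utility.const_mul N.α_pos

variable [Fintype UH] [Fintype UR]

lemma utility_eq_sum (r : UH ⊕ UR → ℝ) : utility N r = ∑ u, userUtility N u (r u) := by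
  rw [Fintype.sum_sum_type, utility, ereal_mul_sum _ N.α_pos.le, ereal_mul_sum _ N.β_pos.le,
    add_comm]
  rfl

lemma tendsto_utility {κ : Type*} {l : Filter κ} {x : κ → UH ⊕ UR → ℝ} {r : UH ⊕ UR → ℝ}
    (hr : ∀ u, 0 ≤ r u) (hx : ∀ᶠ i in l, ∀ u, 0 ≤ x i u) (h : Tendsto x l (𝓝 r)) :
    Tendsto (fun i => utility N (x i)) l (𝓝 (utility N r)) := by
  simp only [utility_eq_sum]
  refine ereal_tendsto_sum _ (fun u => ?_) fun u => (isUtility_userUtility N u).ne_top (hr u)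
  refine ((isUtility_userUtility N u).continuousOn (r u) (hr u)).tendsto.comp ?_
  exact tendsto_nhdsWithin_iff.2 ⟨tendsto_pi_nhds.1 h u, hx.mono fun i hi => hi u⟩

lemma utility_mono {r r' : UH ⊕ UR → ℝ} (hr : ∀ u, 0 ≤ r u) (h : ∀ u, r u ≤ r' u) :
    utility N r ≤ utility N r' := by
  simp only [utility_eq_sum]
  exact Finset.sum_le_sum fun u _ =>
    (isUtility_userUtility N u).mono (hr u) ((hr u).trans (h u)) (h u)

lemma coe_sum_realPart_eq_utility {r : UH ⊕ UR → ℝ} (hr : ∀ u, 0 ≤ r u)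
    (h : utility N r ≠ ⊥) :
    ((∑ u, realPart (userUtility N u) (r u) : ℝ) : EReal) = utility N r := by
  rw [utility_eq_sum] at h ⊢
  rw [ereal_coe_sum]
  refine Finset.sum_congr rfl fun u hu => ?_
  rw [realPart_of_nonneg _ (hr u)]
  exact (isUtility_userUtility N u).coe_toReal (hr u) (ne_bot_of_ereal_sum_ne_bot h hu)

end Utility

/-! ### Limit points in the throughput box and the performance bound. -/

namespace Policy

variable {RRH UH UR KR KH S : Type*} [Fintype RRH] [Fintype UH] [Fintype UR] [Fintype KR]
  [Fintype KH] [MeasurableSpace S] {Ω : Type} [mΩ : MeasurableSpace Ω]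
  {N : Network RRH UH UR KR KH S} {ν : Measure (S × (UH ⊕ UR → ℝ))}
  {P : Measure Ω} [IsProbabilityMeasure P] {γ : ℕ → Ω → UH ⊕ UR → ℝ}
  (hν : ∀ᵐ x ∂ν, ∀ u, 0 ≤ x.2 u ∧ x.2 u ≤ N.Amax u)

lemma average_mem {x : ℕ → ℝ} {A : ℝ} (hA : 0 ≤ A) (h : ∀ t, 0 ≤ x t ∧ x t ≤ A) (T : ℕ) :
    (∑ t ∈ Finset.range T, x t) / T ∈ Icc 0 A := by
  refine ⟨div_nonneg (Finset.sum_nonneg fun t _ => (h t).1) (Nat.cast_nonneg T),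
    div_le_of_le_mul₀ (Nat.cast_nonneg T) hA ?_⟩
  rw [mul_comm, ← nsmul_eq_mul]
  simpa using Finset.sum_le_card_nsmul (Finset.range T) _ _ fun t _ => (h t).2

lemma integral_mem {f : Ω → ℝ} (hf : EssBdd P f) {A : ℝ} (h : ∀ᵐ ω ∂P, 0 ≤ f ω ∧ f ω ≤ A) :
    0 ≤ ∫ ω, f ω ∂P ∧ ∫ ω, f ω ∂P ≤ A := by
  refine ⟨integral_nonneg_of_ae (h.mono fun ω h => h.1), ?_⟩
  calc _ ≤ ∫ _, A ∂P := integral_mono_ae hf.integrable (integrable_const _)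
        (h.mono fun ω h => h.2)
    _ = A := by simp

/-- Average expected auxiliary variables over the first `T` slots. -/
def avgAux (P : Measure Ω) (γ : ℕ → Ω → UH ⊕ UR → ℝ) (T : ℕ) (u : UH ⊕ UR) : ℝ :=
  (∑ t ∈ Finset.range T, ∫ ω, γ t ω u ∂P) / T

include hν in
lemma avgAdm_mem (π : Policy N ν P) (T : ℕ) :
    π.avgAdm T ∈ Set.pi univ fun u => Icc 0 (N.Amax u) := fun u _ =>
  average_mem (N.Amax_nonneg u) (fun t => integral_mem (π.essBdd_adm hν t u)
    ((π.ae_regular hν).mono fun _ h => h.adm_mem t u)) T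

lemma IsAux.avgAux_mem {π : Policy N ν P} (hγ : π.IsAux γ) (T : ℕ) :
    avgAux P γ T ∈ Set.pi univ fun u => Icc 0 (N.Amax u) := fun u _ =>
  average_mem (N.Amax_nonneg u) (fun t => integral_mem (essBdd_aux hγ t u)
    (hγ.ae_regularAux.mono fun _ h => h t u)) T

lemma exists_tendsto_of_mem_box {x : ℕ → UH ⊕ UR → ℝ} {A : UH ⊕ UR → ℝ}
    (hx : ∀ T, x T ∈ Set.pi univ fun u => Icc 0 (A u)) (l : Ultrafilter ℕ) :
    ∃ r, (∀ u, 0 ≤ r u ∧ r u ≤ A u) ∧ Tendsto x l (𝓝 r) := by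
  have hK : IsCompact (Set.pi univ fun u => Icc 0 (A u)) :=
    isCompact_univ_pi fun u => isCompact_Icc
  obtain ⟨r, hr, h⟩ := hK.ultrafilter_le_nhds (l.map x)
    (le_principal_iff.2 (Eventually.of_forall hx : ∀ᶠ T in (l : Filter ℕ), _))
  exact ⟨r, fun u => hr u (mem_univ u), h⟩

/-- Such an ultrafilter replaces a subsequence: all bounded averages converge along it
simultaneously. -/
lemma exists_ultrafilter_of_frequently {p : ℕ → Prop} (h : ∃ᶠ T in atTop, p T) :
    ∃ l : Ultrafilter ℕ, (l : Filter ℕ) ≤ atTop ∧ ∀ᶠ T in (l : Filter ℕ), p T := by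
  have : (atTop ⊓ 𝓟 {T | p T}).NeBot := frequently_iff_neBot.1 h
  obtain ⟨l, hl⟩ := Ultrafilter.exists_le (atTop ⊓ 𝓟 {T | p T})
  exact ⟨l, hl.trans inf_le_left, hl (mem_inf_of_right (mem_principal_self _))⟩

variable [Finite S] [MeasurableSingletonClass S]

/-- The auxiliary variables chosen by the algorithm are at least as good as any constant ones of
finite utility. -/
lemma IsDriftPlusPenalty.aux_compare {V : ℝ} (hV : 0 < V) {π : Policy N ν P}
    (h : π.IsDriftPlusPenalty V γ) {r : UH ⊕ UR → ℝ} (hr : ∀ u, 0 ≤ r u ∧ r u ≤ N.Amax u)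
    (hb : ∀ u, userUtility N u (r u) ≠ ⊥) (t : ℕ) :
    ∀ᵐ ω ∂P, ∀ u, userUtility N u (γ t ω u) ≠ ⊥ ∧
      V * realPart (userUtility N u) (r u) - π.H γ t ω u * r u
        ≤ V * realPart (userUtility N u) (γ t ω u) - π.H γ t ω u * γ t ω u := by
  filter_upwards [h.aux_opt t, h.aux.ae_regularAux] with ω h1 h2 u
  have h3 := h1 u (mem_Icc.2 (hr u))
  simp only [mem_ofPred_eq] at h3
  have hu := isUtility_userUtility N u
  rw [← hu.coe_toReal (hr u).1 (hb u), ← EReal.coe_mul, ← EReal.coe_sub] at h3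
  -- The maximal value dominates the finite one at `r`; since V > 0, a utility of -∞ would make it
  -- -∞.
  have h4 : userUtility N u (γ t ω u) ≠ ⊥ := by
    intro h5
    rw [h5, EReal.coe_mul_bot_of_pos hV, EReal.bot_sub] at h3
    exact EReal.coe_ne_bot _ (le_bot_iff.1 h3)
  refine ⟨h4, ?_⟩
  rw [← hu.coe_toReal (h2 t u).1 h4, ← EReal.coe_mul, ← EReal.coe_sub,
    EReal.coe_le_coe_iff] at h3
  rwa [realPart_of_nonneg _ (hr u).1, realPart_of_nonneg _ (h2 t u).1]

include hν

/-- The algorithm performs, up to `C / V`, at least as well as any achievable throughputs. -/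
theorem IsDriftPlusPenalty.utility_sub_le_liminf {C V : ℝ} (hC : IsDriftConstant N ν C)
    (hV : 0 < V) {π : Policy N ν P} (h : π.IsDriftPlusPenalty V γ) {r : UH ⊕ UR → ℝ}
    (hr : ∀ u, 0 ≤ r u ∧ r u ≤ N.Amax u) (hach : DualAchievable N ν r)
    (hbot : utility N r ≠ ⊥) :
    utility N r - ((C / V : ℝ) : EReal) ≤ liminf (fun T : ℕ => utility N (π.avgAdm T)) atTop := by
  have hb : ∀ u, userUtility N u (r u) ≠ ⊥ := fun u => by
    rw [utility_eq_sum] at hbot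
    exact ne_bot_of_ereal_sum_ne_bot hbot (Finset.mem_univ u)
  set φ : UH ⊕ UR → ℝ → ℝ := fun u => realPart (userUtility N u) with hφdef
  have hcmp := fun t => h.aux_compare hV hr hb t
  have hupper : ∀ t, ∀ᵐ ω ∂P, ∀ u, φ u (γ t ω u) ≤ φ u (N.Amax u) := by
    intro t
    filter_upwards [hcmp t, h.aux.ae_regularAux] with ω h1 h2 u
    simp only [hφdef]
    rw [realPart_of_nonneg _ (h2 t u).1, realPart_of_nonneg _ (N.Amax_nonneg u)]
    exact (isUtility_userUtility N u).toReal_mono (h2 t u).1 (h2 t u).2 (h1 u).1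
  have hφ : ∀ t u, EssBdd P fun ω => φ u (γ t ω u) := by
    intro t u
    -- A utility such as the logarithm is unbounded below near 0. Comparison with `r` gives V φ(γ) ≥
    -- V φ(r) - H r, and H ≤ t Amax, r ≤ Amax yield a lower bound for each slot.
    refine EssBdd.of_mem (a := φ u (r u) - t * N.Amax u * N.Amax u / V) (b := φ u (N.Amax u))
      ((isUtility_userUtility N u).measurable_realPart.comp (essBdd_aux h.aux t u).1) ?_
    filter_upwards [hcmp t, hupper t, h.aux.ae_regularAux, π.ae_regular hν] with ω h1 h2 h3 h4
    refine ⟨?_, h2 u⟩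
    have h5 := (h1 u).2
    have h6 := h4.H_mem h3 t u
    have h7 : π.H γ t ω u * r u ≤ t * N.Amax u * N.Amax u :=
      mul_le_mul h6.2 (hr u).2 (hr u).1 (h6.1.trans h6.2)
    have h8 := mul_nonneg h6.1 (h3 t u).1
    rw [sub_le_iff_le_add, ← sub_le_iff_le_add', le_div_iff₀ hV]
    simp only [hφdef]
    linarith
  have hdrift := fun T => h.integral_lyapunov_le hν hC hach hφ
    (fun t => (hcmp t).mono fun ω h1 u => (h1 u).2) T
  have hsum_upper : ∀ T : ℕ, ∑ u, ∑ t ∈ Finset.range T, ∫ ω, φ u (γ t ω u) ∂P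
      ≤ T * ∑ u, φ u (N.Amax u) := by
    intro T
    rw [Finset.mul_sum]
    refine Finset.sum_le_sum fun u _ => ?_
    rw [← nsmul_eq_mul]
    refine (Finset.sum_le_card_nsmul (Finset.range T) _ (φ u (N.Amax u)) fun t _ => ?_).trans
      (by simp)
    calc _ ≤ ∫ _, φ u (N.Amax u) ∂P := integral_mono_ae (hφ t u).integrable
          (integrable_const _) ((hupper t).mono fun ω h1 => h1 u)
      _ = _ := by simp
  -- Bounding φ(γ) by its value at the peak arrival makes the telescoped bound linear in T.
  have hH := tendsto_H_div hν h.aux (K := C - V * ∑ u, φ u (r u) + V * ∑ u, φ u (N.Amax u))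
    fun T => by
      have h1 := mul_le_mul_of_nonneg_left (hsum_upper T) hV.le
      have h2 := hdrift T
      linarith
  have hJensen : ∀ T : ℕ, 0 < T →
      ((∑ u, φ u (r u) - C / V : ℝ) : EReal) ≤ utility N (avgAux P γ T) := by
    intro T hT
    have hT' : (0 : ℝ) < T := by exact_mod_cast hT
    have h1 : ∀ u, (((∑ t ∈ Finset.range T, ∫ ω, φ u (γ t ω u) ∂P) / T : ℝ) : EReal)
        ≤ userUtility N u (avgAux P γ T u) := fun u =>
      (isUtility_userUtility N u).average_le (fun t => essBdd_aux h.aux t u)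
        (fun t => h.aux.ae_regularAux.mono fun ω h2 => (h2 t u).1) (fun t => hφ t u)
        (fun t => (hcmp t).mono fun ω h2 => (h2 u).1) hT
    rw [utility_eq_sum]
    refine le_trans ?_ (Finset.sum_le_sum fun u _ => h1 u)
    rw [← ereal_coe_sum, EReal.coe_le_coe_iff, ← Finset.sum_div, le_div_iff₀ hT']
    have h2 : 0 ≤ ∫ ω, π.lyapunov γ T ω ∂P := integral_nonneg fun ω => by
      unfold lyapunov
      positivity
    have h3 := h2.trans (hdrift T)
    refine le_of_mul_le_mul_left ?_ hV
    have h4 : V * ((∑ u, φ u (r u) - C / V) * T) = -(T * (C - V * ∑ u, φ u (r u))) := by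
      field_simp
      ring
    linarith
  rw [← coe_sum_realPart_eq_utility N (fun u => (hr u).1) hbot, ← EReal.coe_sub]
  refine le_of_not_gt fun hlt => ?_
  -- If the bound failed, the utility would stay below some `b` along an ultrafilter; the limit of
  -- the average γ then has utility above `b` but is dominated by the limit of the admissions.
  obtain ⟨b, hb1, hb2⟩ := exists_between hlt
  obtain ⟨l, hl, hlb⟩ := exists_ultrafilter_of_frequently
    (frequently_lt_of_liminf_lt (by isBoundedDefault) hb1)
  obtain ⟨ρ, hρ, hρl⟩ := exists_tendsto_of_mem_box (π.avgAdm_mem hν) l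
  obtain ⟨g, hg, hgl⟩ := exists_tendsto_of_mem_box h.aux.avgAux_mem l
  have hgρ : ∀ u, g u ≤ ρ u := by
    intro u
    have h1 : Tendsto (fun T => π.avgAdm T u + (∫ ω, π.H γ T ω u ∂P) / T) l (𝓝 (ρ u + 0)) :=
      (tendsto_pi_nhds.1 hρl u).add ((hH u).mono_left hl)
    rw [add_zero] at h1
    refine le_of_tendsto_of_tendsto' (tendsto_pi_nhds.1 hgl u) h1 fun T => ?_
    rw [avgAux, avgAdm, ← add_div]
    exact div_le_div_of_nonneg_right (avg_aux_le hν π h.aux u T) (Nat.cast_nonneg T)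
  have h1 : ((∑ u, φ u (r u) - C / V : ℝ) : EReal) ≤ utility N g :=
    ge_of_tendsto (tendsto_utility N (fun u => (hg u).1)
      (Eventually.of_forall fun T u => (h.aux.avgAux_mem T u (mem_univ u)).1) hgl)
      (((eventually_gt_atTop 0).filter_mono hl).mono hJensen)
  have h2 : utility N ρ ≤ b :=
    le_of_tendsto (tendsto_utility N (fun u => (hρ u).1)
      (Eventually.of_forall fun T u => (π.avgAdm_mem hν T u (mem_univ u)).1) hρl)
      (hlb.mono fun T hT => hT.le)
  exact absurd ((h1.trans (utility_mono N (fun u => (hg u).1) hgρ)).trans h2) (not_le.2 hb2)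

theorem IsDriftPlusPenalty.optimalUtility_sub_le_liminf {C V : ℝ} (hC : IsDriftConstant N ν C)
    (hV : 0 < V) {π : Policy N ν P} (h : π.IsDriftPlusPenalty V γ) :
    optimalUtility N ν - ((C / V : ℝ) : EReal)
      ≤ liminf (fun T : ℕ => utility N (π.avgAdm T)) atTop := by
  rw [EReal.sub_le_iff_le_add (.inl (EReal.coe_ne_bot _)) (.inl (EReal.coe_ne_top _))]
  refine sSup_le ?_
  rintro v ⟨Ω', _, P', _, π', hQ, hE, rfl⟩
  -- Levels below the competitor's limsup are exceeded infinitely often, so some limit point of its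
  -- throughputs has at least that utility. Two levels c < c' are used so that this utility is not
  -- -∞.
  refine le_of_forall_lt fun c hc => ?_
  obtain ⟨c', hcc', hc'⟩ := exists_between hc
  refine hcc'.trans_le ?_
  obtain ⟨l, hl, hlc⟩ := exists_ultrafilter_of_frequently
    (frequently_lt_of_lt_limsup (by isBoundedDefault) hc')
  obtain ⟨r, hr, hrl⟩ := exists_tendsto_of_mem_box (π'.avgAdm_mem hν) l
  have h1 : c' ≤ utility N r :=
    ge_of_tendsto (tendsto_utility N (fun u => (hr u).1)
      (Eventually.of_forall fun T u => (π'.avgAdm_mem hν T u (mem_univ u)).1) hrl)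
      (hlc.mono fun T hT => hT.le)
  refine h1.trans ?_
  rw [← EReal.sub_le_iff_le_add (.inl (EReal.coe_ne_bot _)) (.inl (EReal.coe_ne_top _))]
  exact h.utility_sub_le_liminf hν hC hV hr (dualAchievable_of_tendsto hν hQ hE hl hrl)
    (bot_le.trans_lt (hcc'.trans_le h1)).ne'

end Policy

end HCRAN

end

theorem theorem4 {RRH UH UR KR KH S : Type*} [Fintype RRH] [Fintype UH] [Fintype UR]
    [Fintype KR] [Fintype KH] [Finite S] [MeasurableSpace S] [MeasurableSingletonClass S]
    (N : HCRAN.Network RRH UH UR KR KH S)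
    (ν : Measure (S × (UH ⊕ UR → ℝ))) [IsProbabilityMeasure ν]
    (hν : ∀ᵐ x ∂ν, ∀ u, 0 ≤ x.2 u ∧ x.2 u ≤ N.Amax u) :
    (∃ C : ℝ, HCRAN.IsDriftConstant N ν C) ∧
    ∀ C : ℝ, HCRAN.IsDriftConstant N ν C → ∀ V : ℝ, 0 < V →
      ∀ (Ω : Type) [MeasurableSpace Ω] (P : Measure Ω) [IsProbabilityMeasure P]
        (π : HCRAN.Policy N ν P) (γ : ℕ → Ω → UH ⊕ UR → ℝ), π.IsDriftPlusPenalty V γ →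
        HCRAN.optimalUtility N ν - ((C / V : ℝ) : EReal)
            ≤ liminf (fun T : ℕ => HCRAN.utility N (π.avgAdm T)) atTop ∧
        ∀ r : UH ⊕ UR → ℝ, (∀ u, Tendsto (fun T : ℕ => π.avgAdm T u) atTop (𝓝 (r u))) →
          HCRAN.optimalUtility N ν - ((C / V : ℝ) : EReal) ≤ HCRAN.utility N r := by
  refine ⟨HCRAN.Policy.exists_isDriftConstant N hν, ?_⟩
  intro C hC V hV Ω _ P _ π γ h
  have key := h.optimalUtility_sub_le_liminf hν hC hV
  refine ⟨key, fun r hr => ?_⟩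
  have hmem := fun T u => (π.avgAdm_mem hν T u (mem_univ u)).1
  rwa [(HCRAN.tendsto_utility N (fun u => ge_of_tendsto' (hr u) fun T => hmem T u)
    (Eventually.of_forall hmem) (tendsto_pi_nhds.2 hr)).liminf_eq] at key
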